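/- Let $(\Omega,\mathcal F,\mathbb P)$ be a probability space with a right-continuous filtration $\mathfrak F=(\mathcal F_t)_{t\ge 0}$ such that $\mathcal F_0$ contains all $\mathbb P$-null sets. Let $Y=(Y(t))_{t\ge0}$ be a real-valued, non-negative, $\mathfrak F$-adapted, right-continuous process with $\mathbb E(\sup_{t\ge0}Y(t))<\infty$. Let $\mathcal S$ be the set of $\mathfrak F$-stopping times with values in $[0,\infty]$, and $\mathcal S_\sigma=\{\tau\in\mathcal S:\tau\ge\sigma\}$ for $\sigma\in\mathcal S$. For a process $U=(U(t))_{t\ge 0}$ put $U(\infty):=\limsup_{t\to\infty}U(t)$. Let $n\ge1$, let $X=(X(t))_{t\ge0}$ be an $\mathfrak F$-adapted right-continuous process with values in a topological space $E$, and let $B_1,\dots,B_{n-1}\subseteq E$ be Borel sets. For a random time $\tau$ with values in $[0,\infty]$ put $$\rho_\tau^{B_i}:=\inf\{t>\tau:\ X(t)\in B_i\},\qquad \inf\emptyset=\infty .$$ Assume that for all $i<n$ and all $s\ge0$ the set $\bigcap_{t>s}\{X(t)\notin B_i\}$ is a $\mathbb P$-null set (that is, $\rho_s^{B_i}<\infty$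 a.s.) and $\rho_s^{B_i}$ is an $\mathfrak F$-stopping time. For $\sigma\in\mathcal S$ define $$\mathcal S_\sigma^n(B):=\{(\tau_1,\dots,\tau_n)\in\mathcal S^n:\ \sigma\le\tau_1,\ \rho^{B_i}_{\tau_i}\le\tau_{i+1}\text{ for all }i<n\},$$ $$Z_n^B(\sigma):=\operatorname*{ess\,sup}_{\tau\in\mathcal S^n_\sigma(B)}\mathbb E\Big(\sum_{i=1}^nY(\tau_i)\,\Big|\,\mathcal F_\sigma\Big),\qquad Z_0:=0 .$$ Write $LB:=(B_2,\dots,B_{n-1})$ and, for $t\ge 0$, $\overline Z_{n-1}^B(t):=\mathbb E\big(Z_{n-1}^{LB}(\rho_t^{B_1})\,\big|\,\mathcal F_t\big)$ (which is $0$ if $n=1$). Then the essential suprema $Z_n^B(\sigma)$, $\sigma\in\mathcal S$, exist as integrable random variables, and $\overline Z_{n-1}^B$ is a supermartingale that has a right-continuous modification. For every right-continuous modification $\overline Z_{n-1}^{B,r}$ of it, the process $Y_n^B:=Y+\overline Z_{n-1}^{B,r}$ is $\mathfrak F$-adapted and right-continuous, $Y_n^B(\tau)$ is integrable for all $\tau\in\mathcal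 S$, and for all $\sigma\in\mathcal S$ $$Z_n^B(\sigma)=\operatorname*{ess\,sup}_{\tau\in\mathcal S_\sigma}\mathbb E\big(Y_n^B(\tau)\,\big|\,\mathcal F_\sigma\big)\quad\text{a.s.}$$ -/

import Mathlib

open MeasureTheory Filter Set
open scoped NNReal ENNReal

namespace MultipleStopping

noncomputable section

/-- All paths of the process are right-continuous. -/
def RightContinuousPaths {Ω : Type*} (Y : ℝ≥0 → Ω → ℝ) : Prop :=
  ∀ ω t, ContinuousWithinAt (fun s => Y s ω) (Ici t) t

/-- The value `Y(τ)` of a process at a random time with values in `[0, ∞]`, where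
`Y(∞) = limsup_{t → ∞} Y(t)`. -/
def valueAt {Ω : Type*} (Y : ℝ≥0 → Ω → ℝ) (τ : Ω → WithTop ℝ≥0) (ω : Ω) : ℝ :=
  if τ ω = ⊤ then limsup (fun t => Y t ω) atTop else stoppedValue Y τ ω

/-- The first time strictly after `τ` at which `X` is in `B`,
`ρ_τ^B = inf {t > τ : X(t) ∈ B}`, with `inf ∅ = ∞`. -/
def entryTime {Ω E : Type*} (X : ℝ≥0 → Ω → E) (B : Set E) (τ : Ω → WithTop ℝ≥0) (ω : Ω) :
    WithTop ℝ≥0 :=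
  sInf {u : WithTop ℝ≥0 | ∃ t : ℝ≥0, u = t ∧ τ ω < t ∧ X t ω ∈ B}

open Classical in
/-- The σ-algebra `F_σ` of a stopping time `σ` (the trivial σ-algebra, and never used, if `σ` is
not a stopping time). -/
@[reducible] def pastOf {Ω : Type*} {m : MeasurableSpace Ω} (F : Filtration ℝ≥0 m) (σ : Ω → WithTop ℝ≥0) :
    MeasurableSpace Ω :=
  if h : IsStoppingTime F σ then h.measurableSpace else ⊥

/-- `Z` is (a version of) the essential supremum of the family `S` of real random variables. -/
def IsEssSupFamily {Ω : Type*} {m : MeasurableSpace Ω} (P : Measure Ω) (S : Set (Ω → ℝ))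
    (Z : Ω → ℝ) : Prop :=
  Measurable Z ∧ (∀ ξ ∈ S, ξ ≤ᵐ[P] Z) ∧
    ∀ W : Ω → ℝ, Measurable W → (∀ ξ ∈ S, ξ ≤ᵐ[P] W) → Z ≤ᵐ[P] W

/-- A version of the essential supremum of a family of random variables. -/
def essSupFamily {Ω : Type*} {m : MeasurableSpace Ω} (P : Measure Ω) (S : Set (Ω → ℝ)) : Ω → ℝ :=
  Classical.epsilon (IsEssSupFamily P S)

/-- The set `S_σ^n(B)` of exercise strategies `(τ_1, …, τ_n)`, with `n = k + 1` and
`B = (B_1, …, B_k)`: stopping times with `σ ≤ τ_1` and `ρ_{τ_i}^{B_i} ≤ τ_{i+1}`. -/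
def strategies {Ω E : Type*} {m : MeasurableSpace Ω} (F : Filtration ℝ≥0 m)
    (X : ℝ≥0 → Ω → E) {k : ℕ} (B : Fin k → Set E) (σ : Ω → WithTop ℝ≥0) :
    Set (Fin (k + 1) → Ω → WithTop ℝ≥0) :=
  {τ | (∀ i, IsStoppingTime F (τ i)) ∧ σ ≤ τ 0 ∧
    ∀ i : Fin k, entryTime X (B i) (τ i.castSucc) ≤ τ i.succ}

/-- The conditional expected rewards `E(∑ Y(τ_i) | F_σ)` of all strategies in `S_σ^n(B)`,
`n = k + 1`. -/
def expectedRewards {Ω E : Type*} {m : MeasurableSpace Ω} (P : Measure Ω) (F : Filtration ℝ≥0 m)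
    (Y : ℝ≥0 → Ω → ℝ) (X : ℝ≥0 → Ω → E) {k : ℕ} (B : Fin k → Set E) (σ : Ω → WithTop ℝ≥0) :
    Set (Ω → ℝ) :=
  {ξ | ∃ τ ∈ strategies F X B σ, ξ = P[fun ω => ∑ i, valueAt Y (τ i) ω | pastOf F σ]}

/-- The value `Z_n^B(σ)` of the multiple stopping problem with `n = k + 1` exercises. -/
def multiValue {Ω E : Type*} {m : MeasurableSpace Ω} (P : Measure Ω) (F : Filtration ℝ≥0 m)
    (Y : ℝ≥0 → Ω → ℝ) (X : ℝ≥0 → Ω → E) {k : ℕ} (B : Fin k → Set E) (σ : Ω → WithTop ℝ≥0) :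
    Ω → ℝ :=
  essSupFamily P (expectedRewards P F Y X B σ)

/-- The process `t ↦ E(Z_{n-1}^{LB}(ρ_t^{B_1}) | F_t)`, where `n = k + 1` and
`LB = (B_2, …, B_k)`. For `n = 1` it is `0`, because `Z_0 = 0`. -/
def continuation {Ω E : Type*} {m : MeasurableSpace Ω} (P : Measure Ω) (F : Filtration ℝ≥0 m)
    (Y : ℝ≥0 → Ω → ℝ) (X : ℝ≥0 → Ω → E) : {k : ℕ} → (Fin k → Set E) → ℝ≥0 → Ω → ℝ
  | 0, _ => 0
  | _ + 1, B => fun t =>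
      P[multiValue P F Y X (Fin.tail B) (entryTime X (B 0) (fun _ => (t : WithTop ℝ≥0))) | F t]

/-- `V` is a modification of the process `Z`, and all its paths are right-continuous. -/
def IsRightContinuousModification {Ω : Type*} {m : MeasurableSpace Ω} (P : Measure Ω)
    (Z V : ℝ≥0 → Ω → ℝ) : Prop :=
  (∀ t, Measurable (V t)) ∧ (∀ t, V t =ᵐ[P] Z t) ∧ RightContinuousPaths V

/-- The conditional expected rewards `E(Y(τ) | F_σ)`, `τ ≥ σ`, of the ordinary stopping problem. -/
def singleRewards {Ω : Type*} {m : MeasurableSpace Ω} (P : Measure Ω) (F : Filtration ℝ≥0 m)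
    (Y : ℝ≥0 → Ω → ℝ) (σ : Ω → WithTop ℝ≥0) : Set (Ω → ℝ) :=
  {ξ | ∃ τ, IsStoppingTime F τ ∧ σ ≤ τ ∧ ξ = P[valueAt Y τ | pastOf F σ]}

end

end MultipleStopping

/-! A strategy with n exercises is a first time τ followed by a strategy with n-1 exercises started
at the entry time ρ_τ after τ. For fixed τ, optimizing over the later exercises gives E(Y(τ) + W(τ)
| F_σ) with W(τ) = E(Z_{n-1}(ρ_τ) | F_τ). The identity therefore follows once W(τ) is known to be
the value at τ, including τ = ∞, of any right-continuous modification V of t ↦ W(t).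

The passage from deterministic to random times rests on `RegularFamily`: a supermartingale
inequality, right-continuity of integrals over sets of the past, agreement on {σ = τ}, and bounds by
multiples of Y(∞) and of tail suprema. The value has these properties for every number of exercises,
without induction on n (`regularFamily_multiValue`), because strategies can be pasted along sets of
the past and shifted slightly to the right (`exists_strategies_tendsto`). Conditioning at the next
entry time preserves them (`RegularFamily.entryTime`).

For a regular family, upcrossing estimates give right limits along the dyadics, and these limits
form a modification (`RegularFamily.exists_modification`). The two bounds and Lévy's theorem force
V(t) → c·Y(∞) (`RegularFamily.ae_tendsto_atTop`), so the limsup defining Y + V at infinity splits.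
For stopping times with countably many values V(τ) = W(τ) by agreement with constants; dyadic
approximation from the right and uniform integrability extend this to all τ, in the form of
integrals over sets of F_τ (`RegularFamily.valueAt_modification`).

Inequalities between conditional expectations are tested on sets of F_σ, so that the inclusion F_σ ⊆
F_τ takes the place of the tower property. -/

namespace MultipleStopping

/-! ### Set integrals and conditional expectations -/

section General

variable {Ω : Type*} {m : MeasurableSpace Ω} {P : Measure Ω}

/-- Sets of 𝒢 suffice as test sets because both functions have 𝒢-measurable versions, so the
comparison can be made for the trimmed measure. -/
theorem ae_le_of_setIntegral_le {𝒢 : MeasurableSpace Ω} (h𝒢 : 𝒢 ≤ m) {f g : Ω → ℝ}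
    (hf : Integrable f P) (hg : Integrable g P) (hfm : AEStronglyMeasurable[𝒢] f P)
    (hgm : AEStronglyMeasurable[𝒢] g P)
    (h : ∀ A, MeasurableSet[𝒢] A → ∫ ω in A, f ω ∂P ≤ ∫ ω in A, g ω ∂P) : f ≤ᵐ[P] g := by
  obtain ⟨f', hf', hff'⟩ := hfm
  obtain ⟨g', hg', hgg'⟩ := hgm
  have key : f' ≤ᵐ[P.trim h𝒢] g' := by
    refine ae_le_of_forall_setIntegral_le ((hf.congr hff').trim h𝒢 hf')
      ((hg.congr hgg').trim h𝒢 hg') fun s hs _ => ?_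
    rw [← setIntegral_trim h𝒢 hf' hs, ← setIntegral_trim h𝒢 hg' hs,
      ← integral_congr_ae (ae_restrict_of_ae hff'), ← integral_congr_ae (ae_restrict_of_ae hgg')]
    exact h s hs
  filter_upwards [ae_le_of_ae_le_trim key, hff', hgg'] with ω h1 h2 h3
  rwa [h2, h3]

/-- Pasting two random variables on a set of `𝒢` turns conditional expectations into their
maximum. -/
theorem exists_condExp_eq_max {𝒢 : MeasurableSpace Ω} (h𝒢 : 𝒢 ≤ m) {S : Set (Ω → ℝ)}
    (hint : ∀ R ∈ S, Integrable R P)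
    (hpaste : ∀ R ∈ S, ∀ R' ∈ S, ∀ A, MeasurableSet[𝒢] A →
      ∃ R'' ∈ S, R'' = A.indicator R + Aᶜ.indicator R')
    {R R' : Ω → ℝ} (hR : R ∈ S) (hR' : R' ∈ S) :
    ∃ R'' ∈ S, P[R'' | 𝒢] =ᵐ[P] fun ω => max ((P[R | 𝒢]) ω) ((P[R' | 𝒢]) ω) := by
  have hA : MeasurableSet[𝒢] {ω | (P[R' | 𝒢]) ω ≤ (P[R | 𝒢]) ω} :=
    measurableSet_le stronglyMeasurable_condExp.measurable stronglyMeasurable_condExp.measurable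
  obtain ⟨R'', hR'', rfl⟩ := hpaste R hR R' hR' _ hA
  refine ⟨_, hR'', ?_⟩
  filter_upwards [condExp_add ((hint R hR).indicator (h𝒢 _ hA))
    ((hint R' hR').indicator (h𝒢 _ hA.compl)) 𝒢, condExp_indicator (hint R hR) hA,
    condExp_indicator (hint R' hR') hA.compl] with ω h1 h2 h3
  rw [h1, Pi.add_apply, h2, h3]
  by_cases h : (P[R' | 𝒢]) ω ≤ (P[R | 𝒢]) ω
  · simp [h]
  · simp [h, (not_le.1 h).le]

variable [IsProbabilityMeasure P]

theorem condExp_le_of_setIntegral_le {𝒢 : MeasurableSpace Ω} (h𝒢 : 𝒢 ≤ m) {f g : Ω → ℝ}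
    (hf : Integrable f P) (hg : Integrable g P) (hgm : AEStronglyMeasurable[𝒢] g P)
    (h : ∀ A, MeasurableSet[𝒢] A → ∫ ω in A, f ω ∂P ≤ ∫ ω in A, g ω ∂P) : P[f | 𝒢] ≤ᵐ[P] g :=
  ae_le_of_setIntegral_le h𝒢 integrable_condExp hg stronglyMeasurable_condExp.aestronglyMeasurable
    hgm fun A hA => (setIntegral_condExp h𝒢 hf hA).trans_le (h A hA)

theorem setIntegral_le_of_condExp_le {𝒢 : MeasurableSpace Ω} (h𝒢 : 𝒢 ≤ m) {f g : Ω → ℝ}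
    (hf : Integrable f P) (hg : Integrable g P) (h : P[f | 𝒢] ≤ᵐ[P] g) {A : Set Ω}
    (hA : MeasurableSet[𝒢] A) : ∫ ω in A, f ω ∂P ≤ ∫ ω in A, g ω ∂P := by
  rw [← setIntegral_condExp h𝒢 hf hA]
  exact setIntegral_mono_ae integrable_condExp.integrableOn hg.integrableOn h

/-- A sequence that converges a.e. and is dominated by conditional expectations of one integrable
function converges in `L¹`. -/
theorem tendsto_setIntegral_of_le_condExp {f : ℕ → Ω → ℝ} {g H : Ω → ℝ}
    {𝒢 : ℕ → MeasurableSpace Ω} (h𝒢 : ∀ j, 𝒢 j ≤ m) (hH : Integrable H P)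
    (hf : ∀ j, AEStronglyMeasurable (f j) P) (hf0 : ∀ j, 0 ≤ᵐ[P] f j)
    (hfH : ∀ j, f j ≤ᵐ[P] P[H | 𝒢 j])
    (hlim : ∀ᵐ ω ∂P, Tendsto (fun j => f j ω) atTop (nhds (g ω))) :
    Integrable g P ∧ ∀ A, Tendsto (fun j => ∫ ω in A, f j ω ∂P) atTop (nhds (∫ ω in A, g ω ∂P)) := by
  have hUI := hH.uniformIntegrable_condExp h𝒢
  have hle : ∀ j, ∀ᵐ ω ∂P, ‖f j ω‖ ≤ ‖(P[H | 𝒢 j]) ω‖ := fun j => by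
    filter_upwards [hf0 j, hfH j] with ω h0 h1
    rw [Real.norm_of_nonneg h0]
    exact h1.trans (le_abs_self _)
  have hUI' : UniformIntegrable f 1 P := by
    refine ⟨hf, fun ε hε => ?_, ?_⟩
    · obtain ⟨δ, hδ, h⟩ := hUI.2.1 hε
      refine ⟨δ, hδ, fun j s hs hsδ => le_trans (eLpNorm_mono_ae ?_) (h j s hs hsδ)⟩
      filter_upwards [hle j] with ω hω
      by_cases hωs : ω ∈ s <;> simp [hωs] ; simpa using hω
    · obtain ⟨C, hC⟩ := hUI.2.2
      exact ⟨C, fun j => (eLpNorm_mono_ae (hle j)).trans (hC j)⟩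
  have hg : Integrable g P := hUI'.integrable_of_ae_tendsto hlim
  refine ⟨hg, fun A => ?_⟩
  refine tendsto_setIntegral_of_L1' g hg.1 (Eventually.of_forall fun j => ?_) ?_ A
  · exact memLp_one_iff_integrable.1 (hUI'.memLp j)
  · exact tendsto_Lp_finite_of_tendsto_ae le_rfl (by simp) hf (memLp_one_iff_integrable.2 hg)
      hUI'.2.1 hlim

/-- Existence of the essential supremum of the conditional expectations of a dominated family of
rewards that is closed under pasting. It is the limit of an increasing sequence of the family. -/
theorem exists_essSup_condExp {𝒢 : MeasurableSpace Ω} (h𝒢 : 𝒢 ≤ m) {S : Set (Ω → ℝ)} {H : Ω → ℝ}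
    (hne : S.Nonempty) (hint : ∀ R ∈ S, Integrable R P) (hH : Integrable H P)
    (hSH : ∀ R ∈ S, R ≤ᵐ[P] H)
    (hpaste : ∀ R ∈ S, ∀ R' ∈ S, ∀ A, MeasurableSet[𝒢] A →
      ∃ R'' ∈ S, R'' = A.indicator R + Aᶜ.indicator R') :
    ∃ Z : Ω → ℝ, StronglyMeasurable[𝒢] Z ∧ Integrable Z P ∧ (∀ R ∈ S, P[R | 𝒢] ≤ᵐ[P] Z) ∧
      ∃ R : ℕ → Ω → ℝ, (∀ n, R n ∈ S) ∧
        (∀ᵐ ω ∂P, Tendsto (fun n => (P[R n | 𝒢]) ω) atTop (nhds (Z ω))) ∧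
        ∀ A, MeasurableSet[𝒢] A →
          Tendsto (fun n => ∫ ω in A, R n ω ∂P) atTop (nhds (∫ ω in A, Z ω ∂P)) := by
  classical
  set I : Set ℝ := (fun R : Ω → ℝ => ∫ ω, R ω ∂P) '' S
  have hIb : BddAbove I := ⟨∫ ω, H ω ∂P, by
    rintro _ ⟨R, hR, rfl⟩
    exact integral_mono_ae (hint R hR) hH (hSH R hR)⟩
  have hIS : ∀ R ∈ S, ∫ ω, R ω ∂P ≤ sSup I := fun R hR => le_csSup hIb ⟨R, hR, rfl⟩
  obtain ⟨u, -, hulim, hu⟩ := exists_seq_tendsto_sSup (hne.image _) hIb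
  choose r hrS hru using hu
  have hmax : ∀ R R' : S, ∃ R'' : S,
      P[(R'' : Ω → ℝ) | 𝒢] =ᵐ[P] fun ω => max ((P[(R : Ω → ℝ) | 𝒢]) ω) ((P[(R' : Ω → ℝ) | 𝒢]) ω) :=
    fun R R' => by
      obtain ⟨R'', h1, h2⟩ := exists_condExp_eq_max h𝒢 hint hpaste R.2 R'.2
      exact ⟨⟨R'', h1⟩, h2⟩
  choose mx hmx using hmax
  -- Pasting each new member of a maximizing sequence onto the previous result makes the conditional
  -- expectations increase while they stay those of members of `S`.
  obtain ⟨Q, hQ0, hQsucc⟩ : ∃ Q : ℕ → S, Q 0 = ⟨r 0, hrS 0⟩ ∧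
      ∀ n, Q (n + 1) = mx (Q n) ⟨r (n + 1), hrS (n + 1)⟩ :=
    ⟨fun n => Nat.rec ⟨r 0, hrS 0⟩ (fun n q => mx q ⟨r (n + 1), hrS (n + 1)⟩) n, rfl,
      fun _ => rfl⟩
  set ξ : ℕ → Ω → ℝ := fun n => P[(Q n).1 | 𝒢] with hξ
  have hmono : ∀ᵐ ω ∂P, Monotone fun n => ξ n ω := by
    have : ∀ᵐ ω ∂P, ∀ n, ξ n ω ≤ ξ (n + 1) ω := ae_all_iff.2 fun n => by
      filter_upwards [hmx (Q n) ⟨r (n + 1), hrS (n + 1)⟩] with ω hω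
      simp only [hξ, hQsucc, hω]
      exact le_max_left _ _
    filter_upwards [this] with ω hω using monotone_nat_of_le_succ hω
  have hrξ : ∀ n, P[r n | 𝒢] ≤ᵐ[P] ξ n := by
    intro n
    cases n with
    | zero => simp only [hξ, hQ0]; exact EventuallyLE.rfl
    | succ n =>
      filter_upwards [hmx (Q n) ⟨r (n + 1), hrS (n + 1)⟩] with ω hω
      simp only [hξ, hQsucc, hω]
      exact le_max_right _ _
  have hξH : ∀ᵐ ω ∂P, ∀ n, ξ n ω ≤ (P[H | 𝒢]) ω := ae_all_iff.2 fun n =>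
    condExp_mono (hint _ (Q n).2) hH (hSH _ (Q n).2)
  set Z : Ω → ℝ := fun ω => ⨆ n, ξ n ω with hZ
  have hξm : ∀ n, Measurable[𝒢] (ξ n) := fun n => stronglyMeasurable_condExp.measurable
  have hZm : StronglyMeasurable[𝒢] Z := (Measurable.iSup hξm).stronglyMeasurable
  have hlim : ∀ᵐ ω ∂P, Tendsto (fun n => ξ n ω) atTop (nhds (Z ω)) := by
    filter_upwards [hmono, hξH] with ω h1 h2
    exact tendsto_atTop_ciSup h1 ⟨_, by rintro _ ⟨n, rfl⟩; exact h2 n⟩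
  have hξint : ∀ n, Integrable (ξ n) P := fun n => integrable_condExp
  have hHint : Integrable (P[H | 𝒢]) P := integrable_condExp
  have hboundint : Integrable (fun ω => |ξ 0 ω| + |(P[H | 𝒢]) ω|) P := (hξint 0).abs.add hHint.abs
  have hξ0Z : ∀ᵐ ω ∂P, ξ 0 ω ≤ Z ω ∧ Z ω ≤ (P[H | 𝒢]) ω := by
    filter_upwards [hmono, hξH, hlim] with ω h1 h2 h3
    exact ⟨h1.ge_of_tendsto h3 0, le_of_tendsto' h3 h2⟩
  have habs : ∀ {a b x : ℝ}, a ≤ x → x ≤ b → |x| ≤ |a| + |b| := fun {a b x} h1 h2 =>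
    abs_le.2 ⟨by linarith [neg_abs_le a, abs_nonneg b], by linarith [le_abs_self b, abs_nonneg a]⟩
  have hZint : Integrable Z P := by
    refine hboundint.mono' (hZm.mono h𝒢).aestronglyMeasurable ?_
    filter_upwards [hξ0Z] with ω h using habs h.1 h.2
  have hdom : ∀ A : Set Ω,
      Tendsto (fun n => ∫ ω in A, ξ n ω ∂P) atTop (nhds (∫ ω in A, Z ω ∂P)) := fun A => by
    refine tendsto_integral_of_dominated_convergence _ (fun n => (hξint n).1.restrict)
      hboundint.integrableOn (fun n => ae_restrict_of_ae ?_) (ae_restrict_of_ae hlim)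
    filter_upwards [hmono, hξH] with ω h1 h2 using habs (h1 (Nat.zero_le n)) (h2 n)
  have hsZ : ∫ ω, Z ω ∂P = sSup I := by
    have h1 : Tendsto (fun n => ∫ ω, ξ n ω ∂P) atTop (nhds (∫ ω, Z ω ∂P)) := by
      simpa using hdom univ
    have h2 : ∀ n, ∫ ω, ξ n ω ∂P = ∫ ω, (Q n).1 ω ∂P := fun n => integral_condExp h𝒢
    refine le_antisymm (le_of_tendsto' h1 fun n => (h2 n).trans_le (hIS _ (Q n).2))
      (le_of_tendsto_of_tendsto' hulim h1 fun n => ?_)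
    rw [← hru n]
    refine (integral_condExp h𝒢).symm.trans_le ?_
    exact integral_mono_ae integrable_condExp (hξint n) (hrξ n)
  refine ⟨Z, hZm, hZint, fun R hR => ?_, fun n => Q n, fun n => (Q n).2, hlim, fun A hA => ?_⟩
  -- The maximum of E(R | 𝒢) and `ξ n` is again attained by a member of `S`, so its integral is at
  -- most `sSup I`, the integral of `Z`. In the limit max(E(R | 𝒢), Z) has no larger integral than
  -- `Z`, hence equals `Z` a.e.
  · have hmZ : Integrable (fun ω => max ((P[R | 𝒢]) ω) (Z ω)) P := integrable_condExp.sup hZint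
    have hlim' : Tendsto (fun n => ∫ ω, max ((P[R | 𝒢]) ω) (ξ n ω) ∂P) atTop
        (nhds (∫ ω, max ((P[R | 𝒢]) ω) (Z ω) ∂P)) := by
      refine tendsto_integral_of_dominated_convergence
        (fun ω => |(P[R | 𝒢]) ω| + (|ξ 0 ω| + |(P[H | 𝒢]) ω|))
        (fun n => (integrable_condExp.sup (hξint n)).1)
        (integrable_condExp.abs.add hboundint) (fun n => ?_) ?_
      · filter_upwards [hmono, hξH] with ω h1 h2
        have := habs (h1 (Nat.zero_le n)) (h2 n)
        refine (abs_max_le_max_abs_abs).trans (max_le ?_ ?_)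
        · linarith [abs_nonneg (ξ 0 ω), abs_nonneg ((P[H | 𝒢]) ω)]
        · linarith [abs_nonneg ((P[R | 𝒢]) ω)]
      · filter_upwards [hlim] with ω h using tendsto_const_nhds.max h
    have hle : ∫ ω, max ((P[R | 𝒢]) ω) (Z ω) ∂P ≤ ∫ ω, Z ω ∂P := by
      rw [hsZ]
      refine le_of_tendsto' hlim' fun n => ?_
      rw [← integral_congr_ae (hmx ⟨R, hR⟩ (Q n)), integral_condExp h𝒢]
      exact hIS _ (mx ⟨R, hR⟩ (Q n)).2
    have hz : (fun ω => max ((P[R | 𝒢]) ω) (Z ω) - Z ω) =ᵐ[P] 0 := by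
      refine (integral_eq_zero_iff_of_nonneg (fun ω => sub_nonneg.2 (le_max_right _ _))
        (hmZ.sub hZint)).1 (le_antisymm ?_ (integral_nonneg fun ω =>
          sub_nonneg.2 (le_max_right _ _)))
      rw [integral_sub hmZ hZint]
      linarith
    filter_upwards [hz] with ω hω
    exact (le_max_left _ _).trans (sub_eq_zero.1 hω).le
  · simpa only [hξ, setIntegral_condExp h𝒢 (hint _ (Q _).2) hA] using hdom A

end General

/-! ### Dyadic approximation from the right -/

/-- The smallest multiple of `2⁻ʲ` that is strictly larger than `t`. -/
noncomputable def dyadicUp (j : ℕ) (t : ℝ≥0) : ℝ≥0 := ((⌊2 ^ j * t⌋₊ + 1 : ℕ) : ℝ≥0) / 2 ^ j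

theorem lt_dyadicUp (j : ℕ) (t : ℝ≥0) : t < dyadicUp j t := by
  rw [dyadicUp, lt_div_iff₀ (by positivity), mul_comm]
  exact_mod_cast Nat.lt_floor_add_one (2 ^ j * t)

theorem dyadicUp_le (j : ℕ) (t : ℝ≥0) : dyadicUp j t ≤ t + (1 / 2) ^ j := by
  rw [dyadicUp, div_le_iff₀ (by positivity), add_mul, ← mul_pow]
  push_cast
  have := Nat.floor_le (zero_le : 0 ≤ 2 ^ j * t)
  rw [mul_comm t]
  simpa using this

theorem tendsto_dyadicUp (t : ℝ≥0) : Tendsto (fun j => dyadicUp j t) atTop (nhds t) := by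
  have h : Tendsto (fun j : ℕ => t + (1 / 2 : ℝ≥0) ^ j) atTop (nhds (t + 0)) :=
    tendsto_const_nhds.add (NNReal.tendsto_pow_atTop_nhds_zero_of_lt_one (by
      rw [div_lt_one (by norm_num)]; norm_num))
  rw [add_zero] at h
  exact tendsto_of_tendsto_of_tendsto_of_le_of_le tendsto_const_nhds h
    (fun j => (lt_dyadicUp j t).le) fun j => dyadicUp_le j t

/-- This is what makes a rounded-up stopping time a stopping time: the event on the left is decided
at a grid point not exceeding i. -/
theorem dyadicUp_le_iff (j : ℕ) (t i : ℝ≥0) :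
    dyadicUp j t ≤ i ↔ t < (⌊2 ^ j * i⌋₊ : ℝ≥0) / 2 ^ j := by
  rw [dyadicUp, div_le_iff₀ (by positivity), lt_div_iff₀ (by positivity), mul_comm i, mul_comm t,
    ← Nat.le_floor_iff zero_le, Nat.succ_le_iff, Nat.floor_lt zero_le]

section Path

variable {f : ℝ≥0 → ℝ}

theorem tendsto_comp_dyadicUp (hf : ∀ t, ContinuousWithinAt f (Ici t) t) (t : ℝ≥0) :
    Tendsto (fun j => f (dyadicUp j t)) atTop (nhds (f t)) :=
  (hf t).tendsto.comp (tendsto_nhdsWithin_iff.2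
    ⟨tendsto_dyadicUp t, Eventually.of_forall fun j => (lt_dyadicUp j t).le⟩)

/-- Each value of f is a limit of dyadic values from the right, so both families have the same upper
bounds. If there are none, both suprema take the default value 0; tail suprema are thus measurable
without exceptional paths. -/
theorem iSup_eq_iSup_dyadic (hf : ∀ t, ContinuousWithinAt f (Ici t) t) :
    ⨆ t, f t = ⨆ p : ℕ × ℕ, f ((p.2 : ℝ≥0) / 2 ^ p.1) := by
  have hub : upperBounds (range f) =
      upperBounds (range fun p : ℕ × ℕ => f ((p.2 : ℝ≥0) / 2 ^ p.1)) := by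
    ext x
    constructor
    · rintro hx _ ⟨p, rfl⟩
      exact hx ⟨_, rfl⟩
    · rintro hx _ ⟨t, rfl⟩
      refine le_of_tendsto' (tendsto_comp_dyadicUp hf t) fun j => hx ⟨(j, ⌊2 ^ j * t⌋₊ + 1), rfl⟩
  by_cases hb : BddAbove (range f)
  · have h1 := isLUB_csSup (range_nonempty f) hb
    have h2 : IsLUB (range fun p : ℕ × ℕ => f ((p.2 : ℝ≥0) / 2 ^ p.1)) (sSup (range f)) := by
      rw [IsLUB, ← hub]; exact h1
    exact (h2.csSup_eq (range_nonempty _)).symm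
  · have hb' : ¬ BddAbove (range fun p : ℕ × ℕ => f ((p.2 : ℝ≥0) / 2 ^ p.1)) := by
      rw [BddAbove, ← hub]; exact hb
    rw [iSup, iSup, Real.sSup_of_not_bddAbove hb, Real.sSup_of_not_bddAbove hb']

end Path

/-! ### Tail suprema and the value at infinity -/

section Tail

variable {Ω : Type*}

/-- The supremum of `Y` over `[T, ∞)`. -/
noncomputable def tailSup (Y : ℝ≥0 → Ω → ℝ) (T : ℝ≥0) (ω : Ω) : ℝ := ⨆ t, Y (T + t) ω

/-- The value `limsup_{t → ∞} Y(t)` of the process at infinity. -/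
noncomputable def limitValue (Y : ℝ≥0 → Ω → ℝ) (ω : Ω) : ℝ := limsup (fun t => Y t ω) atTop

theorem measurable_tailSup {𝒢 : MeasurableSpace Ω} {Y : ℝ≥0 → Ω → ℝ} (hY : ∀ t, Measurable[𝒢] (Y t))
    (hr : RightContinuousPaths Y) (T : ℝ≥0) : Measurable[𝒢] (tailSup Y T) := by
  have : tailSup Y T = fun ω => ⨆ p : ℕ × ℕ, Y (T + (p.2 : ℝ≥0) / 2 ^ p.1) ω := by
    ext ω
    refine iSup_eq_iSup_dyadic (f := fun t => Y (T + t) ω) fun t => ?_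
    refine (hr ω (T + t)).comp (f := fun s => T + s) (by fun_prop) fun s hs => ?_
    have hs' : t ≤ s := hs
    change T + t ≤ T + s
    gcongr
  rw [this]
  exact Measurable.iSup fun p => hY _

variable {Y : ℝ≥0 → Ω → ℝ} {ω : Ω}

theorem bddAbove_shift (hb : BddAbove (range fun t => Y t ω)) (T : ℝ≥0) :
    BddAbove (range fun t => Y (T + t) ω) :=
  hb.mono (by rintro _ ⟨t, rfl⟩; exact ⟨T + t, rfl⟩)

theorem le_tailSup (hb : BddAbove (range fun t => Y t ω)) {T t : ℝ≥0} (h : T ≤ t) :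
    Y t ω ≤ tailSup Y T ω := by
  have := le_ciSup (bddAbove_shift hb T) (t - T)
  simp only [add_tsub_cancel_of_le h] at this
  exact this

theorem tailSup_antitone (hb : BddAbove (range fun t => Y t ω)) :
    Antitone fun T => tailSup Y T ω := fun _ _ h =>
  ciSup_le fun _ => le_tailSup hb (h.trans le_self_add)

theorem tailSup_nonneg (h0 : ∀ t, 0 ≤ Y t ω) (T : ℝ≥0) : 0 ≤ tailSup Y T ω :=
  Real.iSup_nonneg fun _ => h0 _

theorem isBoundedUnder_of_bddAbove (hb : BddAbove (range fun t => Y t ω)) :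
    IsBoundedUnder (· ≤ ·) atTop fun t => Y t ω := by
  obtain ⟨C, hC⟩ := hb
  exact isBoundedUnder_of ⟨C, fun t => hC ⟨t, rfl⟩⟩

theorem isCoboundedUnder_of_nonneg (h0 : ∀ t, 0 ≤ Y t ω) :
    IsCoboundedUnder (· ≤ ·) atTop fun t => Y t ω :=
  IsBoundedUnder.isCoboundedUnder_le (isBoundedUnder_of ⟨0, h0⟩)

theorem limitValue_le_tailSup (h0 : ∀ t, 0 ≤ Y t ω) (hb : BddAbove (range fun t => Y t ω))
    (T : ℝ≥0) : limitValue Y ω ≤ tailSup Y T ω :=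
  limsup_le_of_le (isCoboundedUnder_of_nonneg h0)
    ((eventually_ge_atTop T).mono fun _ h => le_tailSup hb h)

theorem limitValue_nonneg (h0 : ∀ t, 0 ≤ Y t ω) (hb : BddAbove (range fun t => Y t ω)) :
    0 ≤ limitValue Y ω :=
  le_limsup_of_frequently_le (Frequently.of_forall h0) (isBoundedUnder_of_bddAbove hb)

theorem limitValue_eq_iInf (h0 : ∀ t, 0 ≤ Y t ω) (hb : BddAbove (range fun t => Y t ω)) :
    limitValue Y ω = ⨅ n : ℕ, tailSup Y n ω := by
  refine le_antisymm (le_ciInf fun n => limitValue_le_tailSup h0 hb n) ?_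
  refine le_of_forall_pos_sub_le fun ε hε => ?_
  refine le_limsup_of_frequently_le ?_ (isBoundedUnder_of_bddAbove hb)
  refine frequently_atTop.2 fun T => ?_
  obtain ⟨n, hn⟩ := exists_nat_ge T
  have h1 : (⨅ n : ℕ, tailSup Y n ω) ≤ tailSup Y n ω :=
    ciInf_le ⟨0, by rintro _ ⟨n, rfl⟩; exact tailSup_nonneg h0 _⟩ n
  obtain ⟨t, ht⟩ := exists_lt_of_lt_ciSup (show tailSup Y n ω - ε < ⨆ t, Y (n + t) ω by
    rw [tailSup]; linarith)
  exact ⟨n + t, hn.trans le_self_add, by linarith⟩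

theorem tendsto_tailSup (h0 : ∀ t, 0 ≤ Y t ω) (hb : BddAbove (range fun t => Y t ω)) :
    Tendsto (fun n : ℕ => tailSup Y n ω) atTop (nhds (limitValue Y ω)) := by
  rw [limitValue_eq_iInf h0 hb]
  exact tendsto_atTop_ciInf (fun a b h => tailSup_antitone hb (by exact_mod_cast h))
    ⟨0, by rintro _ ⟨n, rfl⟩; exact tailSup_nonneg h0 _⟩

theorem valueAt_of_eq_top {τ : Ω → WithTop ℝ≥0} (h : τ ω = ⊤) :
    valueAt Y τ ω = limitValue Y ω := if_pos h

theorem valueAt_of_eq_coe {τ : Ω → WithTop ℝ≥0} {t : ℝ≥0} (h : τ ω = t) :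
    valueAt Y τ ω = Y t ω := by
  rw [valueAt, if_neg (h ▸ WithTop.coe_ne_top), stoppedValue, h]; rfl

theorem valueAt_congr {σ τ : Ω → WithTop ℝ≥0} (h : σ ω = τ ω) : valueAt Y σ ω = valueAt Y τ ω := by
  simp only [valueAt, stoppedValue, h]

/-- Approximation from the right forces θ_j = ∞ wherever τ = ∞, so no continuity of the path at
infinity is needed. -/
theorem tendsto_valueAt (hr : ∀ t, ContinuousWithinAt (fun s => Y s ω) (Ici t) t)
    {τ : Ω → WithTop ℝ≥0} {θ : ℕ → Ω → WithTop ℝ≥0} (hle : ∀ j, τ ω ≤ θ j ω)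
    (hlim : Tendsto (fun j => θ j ω) atTop (nhds (τ ω))) :
    Tendsto (fun j => valueAt Y (θ j) ω) atTop (nhds (valueAt Y τ ω)) := by
  rcases eq_or_ne (τ ω) ⊤ with h | h
  · rw [valueAt_of_eq_top h]
    refine tendsto_const_nhds.congr fun j => (valueAt_of_eq_top ?_).symm
    exact top_le_iff.1 (h ▸ hle j)
  · obtain ⟨t, ht⟩ := WithTop.ne_top_iff_exists.1 h
    have hu := (WithTop.tendsto_untopA h).comp hlim
    rw [valueAt_of_eq_coe ht.symm]
    have hut : ∀ s : ℝ≥0, (s : WithTop ℝ≥0).untopA = s := fun _ => rfl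
    rw [← ht, hut] at hu
    have hev : ∀ᶠ j in atTop, θ j ω ≠ ⊤ := by
      have := hlim.eventually_lt_const (lt_top_iff_ne_top.2 h)
      exact this.mono fun j hj => hj.ne
    have hge : ∀ᶠ j in atTop, (θ j ω).untopA ∈ Ici t := hev.mono fun j hj => by
      have := hle j
      obtain ⟨s, hs⟩ := WithTop.ne_top_iff_exists.1 hj
      rw [← ht, ← hs] at this
      rw [← hs, hut]
      exact_mod_cast this
    have := (hr t).tendsto.comp (tendsto_nhdsWithin_iff.2 ⟨hu, hge⟩)
    exact this.congr' (hev.mono fun j hj => (if_neg hj).symm)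

end Tail

section Measurability

variable {Ω : Type*} {m : MeasurableSpace Ω}

/-- After dyadic rounding the process depends on time through a countable variable only;
right-continuity gives the limit. -/
theorem measurable_uncurry_of_rightContinuous {Y : ℝ≥0 → Ω → ℝ} (hY : ∀ t, Measurable (Y t))
    (hr : RightContinuousPaths Y) : Measurable fun p : ℝ≥0 × Ω => Y p.1 p.2 := by
  refine measurable_of_tendsto_metrizable (f := fun (j : ℕ) (p : ℝ≥0 × Ω) => Y (dyadicUp j p.1) p.2)
    (fun j => ?_) (tendsto_pi_nhds.2 fun p => tendsto_comp_dyadicUp (hr p.2) p.1)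
  have h1 : Measurable fun q : ℕ × Ω => Y (((q.1 + 1 : ℕ) : ℝ≥0) / 2 ^ j) q.2 :=
    measurable_from_prod_countable_right fun n => hY (((n + 1 : ℕ) : ℝ≥0) / 2 ^ j)
  have h2 : Measurable fun p : ℝ≥0 × Ω => (⌊2 ^ j * p.1⌋₊, p.2) :=
    (Nat.measurable_floor.comp (measurable_fst.const_mul _)).prodMk measurable_snd
  simpa only [dyadicUp, Function.comp_def] using h1.comp h2

theorem aestronglyMeasurable_valueAt {P : Measure Ω} {Y : ℝ≥0 → Ω → ℝ} (hY : ∀ t, Measurable (Y t))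
    (hr : RightContinuousPaths Y) (hL : AEStronglyMeasurable (limitValue Y) P)
    {τ : Ω → WithTop ℝ≥0} (hτ : Measurable τ) : AEStronglyMeasurable (valueAt Y τ) P := by
  have h1 : Measurable fun ω => Y (τ ω).untopA ω :=
    (measurable_uncurry_of_rightContinuous hY hr).comp
      ((WithTop.measurable_untopA.comp hτ).prodMk measurable_id)
  have h2 : MeasurableSet {ω | τ ω = ⊤} := hτ (measurableSet_singleton ⊤)
  refine (AEStronglyMeasurable.piecewise h2 hL.restrict h1.aestronglyMeasurable.restrict).congr ?_
  exact Eventually.of_forall fun ω => rfl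

end Measurability

/-! ### Entry times and discretization of stopping times -/

section EntryTime

variable {Ω E : Type*} {X : ℝ≥0 → Ω → E} {B : Set E} {τ : Ω → WithTop ℝ≥0} {ω : Ω}

theorem entryTime_lt_iff {c : WithTop ℝ≥0} :
    entryTime X B τ ω < c ↔ ∃ t : ℝ≥0, τ ω < t ∧ (t : WithTop ℝ≥0) < c ∧ X t ω ∈ B := by
  rw [entryTime, sInf_lt_iff]
  constructor
  · rintro ⟨_, ⟨t, rfl, h1, h2⟩, h3⟩
    exact ⟨t, h1, h3, h2⟩
  · rintro ⟨t, h1, h2, h3⟩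
    exact ⟨t, ⟨t, rfl, h1, h3⟩, h2⟩

theorem le_entryTime : τ ω ≤ entryTime X B τ ω := by
  refine le_sInf ?_
  rintro _ ⟨t, rfl, h, -⟩
  exact h.le

theorem entryTime_congr {σ : Ω → WithTop ℝ≥0} (h : σ ω = τ ω) :
    entryTime X B σ ω = entryTime X B τ ω := by
  simp only [entryTime, h]

theorem entryTime_mono {σ : Ω → WithTop ℝ≥0} (h : σ ω ≤ τ ω) :
    entryTime X B σ ω ≤ entryTime X B τ ω := by
  refine le_of_forall_gt fun c hc => ?_
  obtain ⟨t, h1, h2, h3⟩ := entryTime_lt_iff.1 hc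
  exact entryTime_lt_iff.2 ⟨t, h.trans_lt h1, h2, h3⟩

theorem tendsto_of_le_of_eventually_lt {α : Type*} [LinearOrder α] [TopologicalSpace α]
    [OrderTopology α] {u : ℕ → α} {a : α} (h1 : ∀ j, a ≤ u j) (h2 : ∀ c > a, ∀ᶠ j in atTop, u j < c) :
    Tendsto u atTop (nhds a) :=
  tendsto_order.2 ⟨fun _ hc => Eventually.of_forall fun j => hc.trans_le (h1 j), h2⟩

/-- The infimum runs over times strictly after τ, and any such time is still strictly after θ_j for
large j. -/
theorem tendsto_entryTime {θ : ℕ → Ω → WithTop ℝ≥0} (hle : ∀ j, τ ω ≤ θ j ω)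
    (hlim : Tendsto (fun j => θ j ω) atTop (nhds (τ ω))) :
    Tendsto (fun j => entryTime X B (θ j) ω) atTop (nhds (entryTime X B τ ω)) := by
  refine tendsto_of_le_of_eventually_lt (fun j => entryTime_mono (hle j)) fun c hc => ?_
  obtain ⟨t, h1, h2, h3⟩ := entryTime_lt_iff.1 hc
  exact (hlim.eventually_lt_const h1).mono fun j hj => entryTime_lt_iff.2 ⟨t, hj, h2, h3⟩

/-- Between τ and a strictly later visit to B there is a dyadic q, so {ρ_τ < t} is a countable union
of events about entry after a deterministic q. Right-continuity of the filtration makes strict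
inequalities sufficient. -/
theorem isStoppingTime_entryTime {m : MeasurableSpace Ω} {F : Filtration ℝ≥0 m}
    [F.IsRightContinuous]
    (hB : ∀ s : ℝ≥0, IsStoppingTime F (entryTime X B fun _ => (s : WithTop ℝ≥0)))
    (hτ : IsStoppingTime F τ) : IsStoppingTime F (entryTime X B τ) := by
  refine isStoppingTime_of_measurableSet_lt_of_isRightContinuous fun t => ?_
  have : {ω | entryTime X B τ ω < t} = ⋃ p : ℕ × ℕ, ⋃ _ : (p.2 : ℝ≥0) / 2 ^ p.1 < t,
      {ω | τ ω ≤ ((p.2 : ℝ≥0) / 2 ^ p.1 : ℝ≥0)} ∩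
      {ω | entryTime X B (fun _ => (((p.2 : ℝ≥0) / 2 ^ p.1 : ℝ≥0) : WithTop ℝ≥0)) ω < t} := by
    ext ω
    simp only [mem_iUnion, mem_inter_iff, mem_ofPred_eq, exists_prop]
    constructor
    · intro h
      obtain ⟨u, h1, h2, h3⟩ := entryTime_lt_iff.1 h
      obtain ⟨s, hs⟩ := WithTop.ne_top_iff_exists.1 (h1.trans_le le_top).ne
      rw [← hs] at h1 ⊢
      have hsu : s < u := by exact_mod_cast h1
      obtain ⟨j, hj⟩ := ((tendsto_dyadicUp s).eventually_lt_const hsu).exists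
      refine ⟨(j, ⌊2 ^ j * s⌋₊ + 1), ?_, ?_, entryTime_lt_iff.2 ⟨u, ?_, h2, h3⟩⟩
      · exact hj.trans (by exact_mod_cast h2)
      · exact WithTop.coe_le_coe.2 (lt_dyadicUp j s).le
      · exact WithTop.coe_lt_coe.2 hj
    · rintro ⟨p, -, h2, h3⟩
      exact (entryTime_mono h2).trans_lt h3
  rw [this]
  refine MeasurableSet.iUnion fun p => MeasurableSet.iUnion fun hp => ?_
  exact (hτ.measurableSet_le _ |> F.mono hp.le _).inter ((hB _).measurableSet_lt t)

/-- The dyadic approximation of a random time from the right. -/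
noncomputable def discretize (j : ℕ) (τ : Ω → WithTop ℝ≥0) (ω : Ω) : WithTop ℝ≥0 :=
  (τ ω).map (dyadicUp j)

theorem le_discretize (j : ℕ) : τ ω ≤ discretize j τ ω := by
  rcases h : τ ω with _ | t
  · simp only [discretize, h]; exact le_rfl
  · simp only [discretize, h]
    exact WithTop.coe_le_coe.2 (lt_dyadicUp j t).le

theorem tendsto_discretize : Tendsto (fun j => discretize j τ ω) atTop (nhds (τ ω)) := by
  rcases h : τ ω with _ | t
  · simp only [discretize, h]; exact tendsto_const_nhds
  · simp only [discretize, h]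
    exact (WithTop.continuous_coe.tendsto t).comp (tendsto_dyadicUp t)

theorem isStoppingTime_discretize {m : MeasurableSpace Ω} {F : Filtration ℝ≥0 m}
    (hτ : IsStoppingTime F τ) (j : ℕ) : IsStoppingTime F (discretize j τ) := by
  intro i
  have : {ω | discretize j τ ω ≤ i} =
      {ω | τ ω < ((⌊2 ^ j * i⌋₊ : ℝ≥0) / 2 ^ j : ℝ≥0)} := by
    ext ω
    rcases h : τ ω with _ | t
    · simp only [discretize, h, mem_ofPred_eq]
      exact iff_of_false (fun h => WithTop.coe_ne_top (top_le_iff.1 h)) not_top_lt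
    · simp only [discretize, h, mem_ofPred_eq]
      have := dyadicUp_le_iff j t i
      exact (WithTop.coe_le_coe (α := ℝ≥0)).trans (this.trans (WithTop.coe_lt_coe (α := ℝ≥0)).symm)
  rw [this]
  refine F.mono ?_ _ (hτ.measurableSet_lt _)
  rw [div_le_iff₀ (by positivity), mul_comm i]
  exact Nat.floor_le zero_le

theorem countable_range_discretize (j : ℕ) : (range (discretize j τ)).Countable := by
  refine (((countable_range fun n : ℕ => (((n + 1 : ℕ) : ℝ≥0) / 2 ^ j : ℝ≥0)).image
    (WithTop.some)).insert ⊤).mono ?_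
  rintro _ ⟨ω, rfl⟩
  rcases h : τ ω with _ | t
  · simp only [discretize, h]; exact Or.inl rfl
  · simp only [discretize, h]; exact Or.inr ⟨_, ⟨⌊2 ^ j * t⌋₊, rfl⟩, rfl⟩

end EntryTime

/-! ### The σ-algebra of a stopping time -/

section PastOf

variable {Ω : Type*} {m : MeasurableSpace Ω} {F : Filtration ℝ≥0 m} {σ τ : Ω → WithTop ℝ≥0}

theorem measurableSet_pastOf (hσ : IsStoppingTime F σ) {A : Set Ω} :
    MeasurableSet[pastOf F σ] A ↔
      MeasurableSet[⨆ t, F t] A ∧ ∀ i : ℝ≥0, MeasurableSet[F i] (A ∩ {ω | σ ω ≤ i}) := by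
  rw [pastOf, dif_pos hσ]
  rfl

theorem pastOf_le (F : Filtration ℝ≥0 m) (σ : Ω → WithTop ℝ≥0) : pastOf F σ ≤ m := by
  by_cases h : IsStoppingTime F σ
  · rw [pastOf, dif_pos h]; exact h.measurableSpace_le
  · rw [pastOf, dif_neg h]; exact bot_le

theorem pastOf_mono (hσ : IsStoppingTime F σ) (hτ : IsStoppingTime F τ) (h : σ ≤ τ) :
    pastOf F σ ≤ pastOf F τ := by
  rw [pastOf, dif_pos hσ, pastOf, dif_pos hτ]
  exact hσ.measurableSpace_mono hτ h

theorem not_top_le_coe (i : ℝ≥0) : ¬ (⊤ : WithTop ℝ≥0) ≤ i := fun h =>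
  WithTop.coe_ne_top (top_le_iff.1 h)

theorem isStoppingTime_top : IsStoppingTime F fun _ => ⊤ := fun i => by
  have : {ω : Ω | (⊤ : WithTop ℝ≥0) ≤ i} = ∅ :=
    eq_empty_of_forall_notMem fun _ h => (not_top_le_coe i) h
  rw [this]
  exact @MeasurableSet.empty _ (F i)

theorem pastOf_const (t : ℝ≥0) : pastOf F (fun _ => (t : WithTop ℝ≥0)) = F t := by
  rw [pastOf, dif_pos (isStoppingTime_const F t)]
  exact IsStoppingTime.measurableSpace_const F t

theorem pastOf_top : pastOf F (fun _ => ⊤) = ⨆ t, F t := by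
  refine MeasurableSpace.ext fun A => ?_
  rw [measurableSet_pastOf isStoppingTime_top]
  refine and_iff_left fun i => ?_
  have : A ∩ {ω : Ω | (⊤ : WithTop ℝ≥0) ≤ i} = ∅ :=
    eq_empty_of_forall_notMem fun _ h => (not_top_le_coe i) h.2
  rw [this]
  exact @MeasurableSet.empty _ (F i)

theorem measurableSet_pastOf_eq (hσ : IsStoppingTime F σ) (hτ : IsStoppingTime F τ) :
    MeasurableSet[pastOf F σ] {ω | σ ω = τ ω} := by
  rw [pastOf, dif_pos hσ]
  exact hσ.measurableSet_eq_stopping_time hτ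

/-- On such a set the events {σ ≤ i} and {τ ≤ i} coincide; the two pasts thus have the same trace on
{σ = τ}. -/
theorem MeasurableSet.pastOf_of_subset_eq (hσ : IsStoppingTime F σ) (hτ : IsStoppingTime F τ)
    {A : Set Ω} (hA : MeasurableSet[pastOf F σ] A) (h : ∀ ω ∈ A, σ ω = τ ω) :
    MeasurableSet[pastOf F τ] A := by
  rw [measurableSet_pastOf hσ] at hA
  rw [measurableSet_pastOf hτ]
  refine ⟨hA.1, fun i => ?_⟩
  have : A ∩ {ω | τ ω ≤ i} = A ∩ {ω | σ ω ≤ i} := by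
    ext ω
    refine and_congr_right fun hω => ?_
    rw [mem_ofPred_eq, mem_ofPred_eq, h ω hω]
  rw [this]
  exact hA.2 i

open Classical in
-- Membership in A is known at time σ, and neither alternative acts before σ.
theorem isStoppingTime_piecewise (hσ : IsStoppingTime F σ) {A : Set Ω}
    (hA : MeasurableSet[pastOf F σ] A) {τ τ' : Ω → WithTop ℝ≥0} (hτ : IsStoppingTime F τ)
    (hτ' : IsStoppingTime F τ') (h : ∀ ω ∈ A, σ ω ≤ τ ω) (h' : ∀ ω ∉ A, σ ω ≤ τ' ω) :
    IsStoppingTime F (A.piecewise τ τ') := by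
  intro i
  have hAc := ((measurableSet_pastOf hσ).1 hA.compl).2 i
  have hA := ((measurableSet_pastOf hσ).1 hA).2 i
  have : {ω | A.piecewise τ τ' ω ≤ i} =
      (A ∩ {ω | σ ω ≤ i}) ∩ {ω | τ ω ≤ i} ∪ (Aᶜ ∩ {ω | σ ω ≤ i}) ∩ {ω | τ' ω ≤ i} := by
    ext ω
    by_cases hω : ω ∈ A
    · simp only [mem_ofPred_eq, piecewise_eq_of_mem _ _ _ hω, mem_union, mem_inter_iff, hω,
        mem_compl_iff, true_and, not_true, false_and, or_false]
      exact ⟨fun h1 => ⟨(h ω hω).trans h1, h1⟩, fun h1 => h1.2⟩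
    · simp only [mem_ofPred_eq, piecewise_eq_of_notMem _ _ _ hω, mem_union, mem_inter_iff, hω,
        mem_compl_iff, true_and, not_false_iff, false_and, false_or]
      exact ⟨fun h1 => ⟨(h' ω hω).trans h1, h1⟩, fun h1 => h1.2⟩
  rw [this]
  exact (hA.inter (hτ i)).union (hAc.inter (hτ' i))

end PastOf

/-! ### Integrable reward processes -/

section Reward

variable {Ω : Type*} {m : MeasurableSpace Ω}

/-- Adapted non-negative right-continuous processes with integrable supremum. -/
structure IsReward (P : Measure Ω) (F : Filtration ℝ≥0 m) (Y : ℝ≥0 → Ω → ℝ) : Prop where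
  adapted : Adapted F Y
  nonneg : ∀ t ω, 0 ≤ Y t ω
  right : RightContinuousPaths Y
  sup : ∫⁻ ω, ⨆ t, ENNReal.ofReal (Y t ω) ∂P < ∞

variable {P : Measure Ω} {F : Filtration ℝ≥0 m} {Y : ℝ≥0 → Ω → ℝ}

namespace IsReward

theorem measurable (hY : IsReward P F Y) (t : ℝ≥0) : Measurable (Y t) :=
  (hY.adapted t).mono (F.le t) le_rfl

/-- The dyadic supremum is measurable, being countable, so it is finite a.e.; right-continuity
extends the bound to all times. -/
theorem ae_bddAbove (hY : IsReward P F Y) : ∀ᵐ ω ∂P, BddAbove (range fun t => Y t ω) := by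
  have hm : Measurable fun ω => ⨆ p : ℕ × ℕ, ENNReal.ofReal (Y ((p.2 : ℝ≥0) / 2 ^ p.1) ω) :=
    Measurable.iSup fun p => (hY.measurable _).ennreal_ofReal
  have hlt : ∫⁻ ω, ⨆ p : ℕ × ℕ, ENNReal.ofReal (Y ((p.2 : ℝ≥0) / 2 ^ p.1) ω) ∂P < ∞ := by
    refine lt_of_le_of_lt (lintegral_mono fun ω => ?_) hY.sup
    exact iSup_le fun p => le_iSup (fun t => ENNReal.ofReal (Y t ω)) _
  filter_upwards [ae_lt_top hm hlt.ne] with ω hω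
  refine ⟨(⨆ p : ℕ × ℕ, ENNReal.ofReal (Y ((p.2 : ℝ≥0) / 2 ^ p.1) ω)).toReal, ?_⟩
  rintro _ ⟨t, rfl⟩
  refine le_of_tendsto' (tendsto_comp_dyadicUp (hY.right ω) t) fun j => ?_
  rw [← ENNReal.ofReal_le_iff_le_toReal hω.ne]
  exact le_iSup (fun p : ℕ × ℕ => ENNReal.ofReal (Y ((p.2 : ℝ≥0) / 2 ^ p.1) ω))
    (j, ⌊2 ^ j * t⌋₊ + 1)

theorem integrable_tailSup (hY : IsReward P F Y) (T : ℝ≥0) : Integrable (tailSup Y T) P := by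
  have hm : Measurable (tailSup Y T) := measurable_tailSup hY.measurable hY.right T
  refine ⟨hm.aestronglyMeasurable, ?_⟩
  rw [hasFiniteIntegral_iff_ofReal (Eventually.of_forall fun ω =>
    tailSup_nonneg (fun t => hY.nonneg t ω) T)]
  refine lt_of_le_of_lt (lintegral_mono fun ω => ?_) hY.sup
  by_cases h : ⨆ t, ENNReal.ofReal (Y t ω) = ∞
  · rw [h]; exact le_top
  · refine ENNReal.ofReal_le_of_le_toReal (ciSup_le fun t => ?_)
    rw [← ENNReal.ofReal_le_iff_le_toReal h]
    exact le_iSup (fun t => ENNReal.ofReal (Y t ω)) _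

theorem ae_limitValue (hY : IsReward P F Y) :
    ∀ᵐ ω ∂P, 0 ≤ limitValue Y ω ∧ ∀ T, limitValue Y ω ≤ tailSup Y T ω := by
  filter_upwards [hY.ae_bddAbove] with ω hω
  exact ⟨limitValue_nonneg (fun t => hY.nonneg t ω) hω,
    limitValue_le_tailSup (fun t => hY.nonneg t ω) hω⟩

theorem aestronglyMeasurable_limitValue (hY : IsReward P F Y) :
    AEStronglyMeasurable[⨆ t, F t] (limitValue Y) P := by
  have hm : Measurable[⨆ t, F t] fun ω => ⨅ n : ℕ, tailSup Y n ω :=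
    Measurable.iInf fun n => measurable_tailSup
      (fun t => (hY.adapted t).mono (le_iSup (fun t => F t) t) le_rfl) hY.right n
  refine ⟨_, hm.stronglyMeasurable, ?_⟩
  filter_upwards [hY.ae_bddAbove] with ω hω
  exact limitValue_eq_iInf (fun t => hY.nonneg t ω) hω

theorem integrable_limitValue (hY : IsReward P F Y) : Integrable (limitValue Y) P := by
  refine (hY.integrable_tailSup 0).mono'
    (hY.aestronglyMeasurable_limitValue.mono (iSup_le fun t => F.le t)) ?_
  filter_upwards [hY.ae_limitValue] with ω hω
  rw [Real.norm_of_nonneg hω.1]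
  exact hω.2 0

/-- The exceptional set depends only on the paths of Y, so one null set serves all random times,
measurable or not. -/
theorem ae_valueAt (hY : IsReward P F Y) : ∀ᵐ ω ∂P, ∀ τ : Ω → WithTop ℝ≥0,
    0 ≤ valueAt Y τ ω ∧ ∀ T : ℝ≥0, T ≤ τ ω → valueAt Y τ ω ≤ tailSup Y T ω := by
  filter_upwards [hY.ae_bddAbove, hY.ae_limitValue] with ω hω hL τ
  rcases h : τ ω with _ | t
  · rw [valueAt_of_eq_top h]
    exact ⟨hL.1, fun T _ => hL.2 T⟩
  · rw [valueAt_of_eq_coe h]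
    exact ⟨hY.nonneg t ω, fun T hT => le_tailSup hω (WithTop.coe_le_coe.1 hT)⟩

theorem integrable_valueAt (hY : IsReward P F Y) {τ : Ω → WithTop ℝ≥0}
    (hτ : IsStoppingTime F τ) : Integrable (valueAt Y τ) P := by
  refine (hY.integrable_tailSup 0).mono' (aestronglyMeasurable_valueAt hY.measurable hY.right
    hY.integrable_limitValue.1 hτ.measurable') ?_
  filter_upwards [hY.ae_valueAt] with ω hω
  rw [Real.norm_of_nonneg (hω τ).1]
  exact (hω τ).2 0 (by exact bot_le)

end IsReward

end Reward

/-! ### Regular families indexed by stopping times -/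

section RegularFamily

variable {Ω : Type*} {m : MeasurableSpace Ω}

/-- A family of random variables indexed by stopping times that is a right-continuous
supermartingale system between the conditional expectations of `c · Y(∞)` and of the multiples
`c · sup_{t ≥ T} Y(t)`. -/
structure RegularFamily (P : Measure Ω) (F : Filtration ℝ≥0 m) (Y : ℝ≥0 → Ω → ℝ) (c : ℝ)
    (W : (Ω → WithTop ℝ≥0) → Ω → ℝ) : Prop where
  const_nonneg : 0 ≤ c
  integrable : ∀ {σ}, IsStoppingTime F σ → Integrable (W σ) P
  meas : ∀ {σ}, IsStoppingTime F σ → AEStronglyMeasurable[pastOf F σ] (W σ) P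
  super : ∀ {σ τ}, IsStoppingTime F σ → IsStoppingTime F τ → σ ≤ τ →
    ∀ A, MeasurableSet[pastOf F σ] A → ∫ ω in A, W τ ω ∂P ≤ ∫ ω in A, W σ ω ∂P
  rightCont : ∀ {σ} {θ : ℕ → Ω → WithTop ℝ≥0}, IsStoppingTime F σ →
    (∀ j, IsStoppingTime F (θ j)) → (∀ j, σ ≤ θ j) →
    (∀ ω, Tendsto (fun j => θ j ω) atTop (nhds (σ ω))) → ∀ A, MeasurableSet[pastOf F σ] A →
    Tendsto (fun j => ∫ ω in A, W (θ j) ω ∂P) atTop (nhds (∫ ω in A, W σ ω ∂P))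
  congr : ∀ {σ τ}, IsStoppingTime F σ → IsStoppingTime F τ →
    ∀ᵐ ω ∂P, σ ω = τ ω → W σ ω = W τ ω
  lower : ∀ {σ}, IsStoppingTime F σ → ∀ A, MeasurableSet[pastOf F σ] A →
    ∫ ω in A, c * limitValue Y ω ∂P ≤ ∫ ω in A, W σ ω ∂P
  upper : ∀ {σ}, IsStoppingTime F σ → ∀ T : ℝ≥0, (∀ ω, T ≤ σ ω) →
    ∀ A, MeasurableSet[pastOf F σ] A → ∫ ω in A, W σ ω ∂P ≤ ∫ ω in A, c * tailSup Y T ω ∂P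

variable {P : Measure Ω} {F : Filtration ℝ≥0 m} {Y : ℝ≥0 → Ω → ℝ}
  {c : ℝ} {W : (Ω → WithTop ℝ≥0) → Ω → ℝ} {σ τ : Ω → WithTop ℝ≥0}

theorem regularFamily_zero : RegularFamily P F Y 0 fun _ => 0 where
  const_nonneg := le_rfl
  integrable _ := integrable_zero _ _ _
  meas _ := stronglyMeasurable_zero.aestronglyMeasurable
  super _ _ _ _ _ := le_rfl
  rightCont _ _ _ _ _ _ := tendsto_const_nhds
  congr _ _ := Eventually.of_forall fun _ _ => rfl
  lower _ _ _ := by simp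
  upper _ _ _ _ _ := by simp

variable [IsProbabilityMeasure P]

namespace RegularFamily

theorem le_condExp (h : RegularFamily P F Y c W) (hY : IsReward P F Y) (hσ : IsStoppingTime F σ)
    {T : ℝ≥0} (hT : ∀ ω, T ≤ σ ω) : W σ ≤ᵐ[P] P[fun ω => c * tailSup Y T ω | pastOf F σ] :=
  ae_le_of_setIntegral_le (pastOf_le F σ) (h.integrable hσ) integrable_condExp (h.meas hσ)
    stronglyMeasurable_condExp.aestronglyMeasurable fun A hA => by
      rw [setIntegral_condExp (pastOf_le F σ) ((hY.integrable_tailSup T).const_mul c) hA]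
      exact h.upper hσ T hT A hA

theorem condExp_le (h : RegularFamily P F Y c W) (hY : IsReward P F Y) (hσ : IsStoppingTime F σ) :
    P[fun ω => c * limitValue Y ω | pastOf F σ] ≤ᵐ[P] W σ :=
  condExp_le_of_setIntegral_le (pastOf_le F σ) (hY.integrable_limitValue.const_mul c)
    (h.integrable hσ) (h.meas hσ) (h.lower hσ)

theorem nonneg (h : RegularFamily P F Y c W) (hY : IsReward P F Y) (hσ : IsStoppingTime F σ) :
    0 ≤ᵐ[P] W σ := by
  refine EventuallyLE.trans (condExp_nonneg ?_) (h.condExp_le hY hσ)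
  filter_upwards [hY.ae_limitValue] with ω hω using mul_nonneg h.const_nonneg hω.1

/-- At infinity a regular family is `c · Y(∞)`. -/
theorem top (h : RegularFamily P F Y c W) (hY : IsReward P F Y) :
    W (fun _ => ⊤) =ᵐ[P] fun ω => c * limitValue Y ω := by
  have hlow := h.condExp_le hY isStoppingTime_top
  -- Tail suprema are measurable for the past of ∞, so conditioning leaves them unchanged, and
  -- `upper` becomes a pointwise bound for every T.
  have hmeas : ∀ T : ℕ, P[fun ω => c * tailSup Y T ω | pastOf F fun _ => ⊤] =
      fun ω => c * tailSup Y T ω := fun T => by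
    refine condExp_of_stronglyMeasurable (pastOf_le F _) ?_ ((hY.integrable_tailSup T).const_mul c)
    rw [pastOf_top]
    exact ((measurable_tailSup (fun t => (hY.adapted t).mono (le_iSup (fun t => F t) t) le_rfl)
      hY.right T).const_mul c).stronglyMeasurable
  have hL : P[fun ω => c * limitValue Y ω | pastOf F fun _ => ⊤] =ᵐ[P]
      fun ω => c * limitValue Y ω := by
    refine condExp_of_aestronglyMeasurable' (pastOf_le F _) ?_
      (hY.integrable_limitValue.const_mul c)
    rw [pastOf_top]
    exact hY.aestronglyMeasurable_limitValue.const_mul c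
  have hup : ∀ᵐ ω ∂P, ∀ T : ℕ, W (fun _ => ⊤) ω ≤ c * tailSup Y T ω := ae_all_iff.2 fun T => by
    have := h.le_condExp hY isStoppingTime_top (T := T) fun _ => le_top
    rwa [hmeas T] at this
  filter_upwards [hlow, hL, hup, hY.ae_bddAbove] with ω h1 h2 h3 h4
  refine le_antisymm (ge_of_tendsto' ((tendsto_tailSup (fun t => hY.nonneg t ω) h4).const_mul c) h3)
    (h2 ▸ h1)

/-- The conditional expectation of a regular family at the next entry time is a regular family. -/
theorem entryTime {E : Type*} {X : ℝ≥0 → Ω → E} {B : Set E} (h : RegularFamily P F Y c W)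
    (hB : ∀ {τ}, IsStoppingTime F τ → IsStoppingTime F (entryTime X B τ)) :
    RegularFamily P F Y c fun τ => P[W (MultipleStopping.entryTime X B τ) | pastOf F τ] := by
  have hint : ∀ {τ}, IsStoppingTime F τ → ∀ A, MeasurableSet[pastOf F τ] A →
      ∫ ω in A, (P[W (MultipleStopping.entryTime X B τ) | pastOf F τ]) ω ∂P =
        ∫ ω in A, W (MultipleStopping.entryTime X B τ) ω ∂P := fun hτ A hA =>
    setIntegral_condExp (pastOf_le F _) (h.integrable (hB hτ)) hA
  have hmono : ∀ {τ}, IsStoppingTime F τ →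
      pastOf F τ ≤ pastOf F (MultipleStopping.entryTime X B τ) := fun hτ =>
    pastOf_mono hτ (hB hτ) fun _ => le_entryTime
  refine ⟨h.const_nonneg, fun _ => integrable_condExp,
    fun _ => stronglyMeasurable_condExp.aestronglyMeasurable, fun {σ τ} hσ hτ hle A hA => ?_,
    fun {σ θ} hσ hθ hle hlim A hA => ?_, fun {σ τ} hσ hτ => ?_, fun {σ} hσ A hA => ?_,
    fun {σ} hσ T hT A hA => ?_⟩
  · rw [hint hσ A hA, hint hτ A (pastOf_mono hσ hτ hle _ hA)]
    exact h.super (hB hσ) (hB hτ) (fun ω => entryTime_mono (hle ω)) A (hmono hσ _ hA)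
  · rw [hint hσ A hA]
    refine (h.rightCont (hB hσ) (fun j => hB (hθ j)) (fun j ω => entryTime_mono (hle j ω))
      (fun ω => tendsto_entryTime (fun j => hle j ω) (hlim ω)) A (hmono hσ _ hA)).congr fun j => ?_
    exact (hint (hθ j) A (pastOf_mono hσ (hθ j) (hle j) _ hA)).symm
  · have hD := measurableSet_pastOf_eq hσ hτ
    have hD' : MeasurableSet[pastOf F τ] {ω | σ ω = τ ω} :=
      MeasurableSet.pastOf_of_subset_eq hσ hτ hD fun _ => id
    -- Both pasts have the same trace on {σ = τ}, so the conditioning σ-algebra can be exchanged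
    -- there; afterwards the integrands agree on this set because the entry times do.
    have h1 : P[W (MultipleStopping.entryTime X B σ) | pastOf F σ]
        =ᵐ[P.restrict {ω | σ ω = τ ω}] P[W (MultipleStopping.entryTime X B σ) | pastOf F τ] := by
      refine condExp_ae_eq_restrict_of_measurableSpace_eq_on (pastOf_le F σ) (pastOf_le F τ) hD
        fun t => ⟨fun ht => MeasurableSet.pastOf_of_subset_eq hσ hτ ht fun _ h => h.1,
          fun ht => MeasurableSet.pastOf_of_subset_eq hτ hσ ht fun _ h => h.1.symm⟩
    have h2 : {ω | σ ω = τ ω}.indicator (W (MultipleStopping.entryTime X B σ)) =ᵐ[P]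
        {ω | σ ω = τ ω}.indicator (W (MultipleStopping.entryTime X B τ)) := by
      filter_upwards [h.congr (hB hσ) (hB hτ)] with ω hω
      by_cases hωD : σ ω = τ ω
      · simp [hωD, hω (entryTime_congr hωD)]
      · simp [hωD]
    filter_upwards [(ae_restrict_iff' (pastOf_le F σ _ hD)).1 h1,
      condExp_congr_ae (m := pastOf F τ) h2, condExp_indicator (h.integrable (hB hσ)) hD',
      condExp_indicator (h.integrable (hB hτ)) hD'] with ω e1 e2 e3 e4 hω
    rw [e1 hω]
    rw [e3, e4] at e2
    simpa [hω] using e2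
  · rw [hint hσ A hA]
    exact h.lower (hB hσ) A (hmono hσ _ hA)
  · rw [hint hσ A hA]
    exact h.upper (hB hσ) T (fun ω => (hT ω).trans le_entryTime) A (hmono hσ _ hA)

end RegularFamily

end RegularFamily

/-! ### The value of the multiple stopping problem -/

section Value

variable {Ω E : Type*} {m : MeasurableSpace Ω} {P : Measure Ω} {F : Filtration ℝ≥0 m}
  {Y : ℝ≥0 → Ω → ℝ} {X : ℝ≥0 → Ω → E} {k : ℕ} {B : Fin k → Set E} {σ τ : Ω → WithTop ℝ≥0}

/-- The total reward of a strategy. -/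
noncomputable def reward (Y : ℝ≥0 → Ω → ℝ) {k : ℕ} (τ : Fin (k + 1) → Ω → WithTop ℝ≥0) (ω : Ω) :
    ℝ := ∑ i, valueAt Y (τ i) ω

theorem le_of_mem_strategies {τ : Fin (k + 1) → Ω → WithTop ℝ≥0} (hτ : τ ∈ strategies F X B σ)
    (i : Fin (k + 1)) : σ ≤ τ i := by
  induction i using Fin.induction with
  | zero => exact hτ.2.1
  | succ i ih => exact fun ω => ((ih ω).trans le_entryTime).trans (hτ.2.2 i ω)

theorem strategies_antitone (h : σ ≤ τ) : strategies F X B τ ⊆ strategies F X B σ :=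
  fun _ hθ => ⟨hθ.1, h.trans hθ.2.1, hθ.2.2⟩

theorem top_mem_strategies : (fun _ _ => ⊤) ∈ strategies F X B σ :=
  ⟨fun _ => isStoppingTime_top, fun _ => le_top, fun _ _ => le_top⟩

open Classical in
-- An entry time at ω depends only on the path and on the starting value at ω, so the constraints
-- can be checked separately on A and off A.
theorem piecewise_mem_strategies (hσ : IsStoppingTime F σ) {A : Set Ω}
    (hA : MeasurableSet[pastOf F σ] A) {τ τ' : Fin (k + 1) → Ω → WithTop ℝ≥0}
    (hτ : τ ∈ strategies F X B σ) (hτ' : τ' ∈ strategies F X B σ) :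
    (fun i => A.piecewise (τ i) (τ' i)) ∈ strategies F X B σ := by
  refine ⟨fun i => isStoppingTime_piecewise hσ hA (hτ.1 i) (hτ'.1 i)
    (fun ω _ => le_of_mem_strategies hτ i ω) fun ω _ => le_of_mem_strategies hτ' i ω,
    fun ω => ?_, fun i ω => ?_⟩
  · by_cases hω : ω ∈ A
    · simpa [hω] using hτ.2.1 ω
    · simpa [hω] using hτ'.2.1 ω
  · change entryTime X (B i) (A.piecewise (τ i.castSucc) (τ' i.castSucc)) ω ≤
      A.piecewise (τ i.succ) (τ' i.succ) ω
    by_cases hω : ω ∈ A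
    · rw [entryTime_congr (piecewise_eq_of_mem A _ _ hω), piecewise_eq_of_mem A _ _ hω]
      exact hτ.2.2 i ω
    · rw [entryTime_congr (piecewise_eq_of_notMem A _ _ hω), piecewise_eq_of_notMem A _ _ hω]
      exact hτ'.2.2 i ω

open Classical in
/-- A strategy for `σ` can be changed off a set where `σ = τ` into a strategy for `τ`. -/
theorem piecewise_top_mem_strategies (hσ : IsStoppingTime F σ) {A : Set Ω}
    (hA : MeasurableSet[pastOf F σ] A) (h : ∀ ω ∈ A, σ ω = τ ω)
    {θ : Fin (k + 1) → Ω → WithTop ℝ≥0} (hθ : θ ∈ strategies F X B σ) :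
    (fun i => A.piecewise (θ i) fun _ => ⊤) ∈ strategies F X B τ := by
  refine ⟨fun i => isStoppingTime_piecewise hσ hA (hθ.1 i) isStoppingTime_top
    (fun ω _ => le_of_mem_strategies hθ i ω) fun ω _ => le_top, fun ω => ?_, fun i ω => ?_⟩
  · by_cases hω : ω ∈ A
    · simpa [hω, ← h ω hω] using hθ.2.1 ω
    · simp [hω]
  · change entryTime X (B i) (A.piecewise (θ i.castSucc) fun _ => ⊤) ω ≤
      A.piecewise (θ i.succ) (fun _ => ⊤) ω
    by_cases hω : ω ∈ A
    · rw [entryTime_congr (piecewise_eq_of_mem A _ _ hω), piecewise_eq_of_mem A _ _ hω]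
      exact hθ.2.2 i ω
    · rw [piecewise_eq_of_notMem A _ _ hω]
      exact le_top

/-- Strategies are continuous from the right in the starting time. -/
theorem exists_strategies_tendsto (hB : ∀ (i : Fin k) {τ}, IsStoppingTime F τ →
      IsStoppingTime F (entryTime X (B i) τ))
    {θ : ℕ → Ω → WithTop ℝ≥0} (hθ : ∀ j, IsStoppingTime F (θ j))
    (hlim : ∀ ω, Tendsto (fun j => θ j ω) atTop (nhds (σ ω)))
    {τ : Fin (k + 1) → Ω → WithTop ℝ≥0} (hτ : τ ∈ strategies F X B σ) :
    ∃ η : ℕ → Fin (k + 1) → Ω → WithTop ℝ≥0, (∀ j, η j ∈ strategies F X B (θ j)) ∧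
      (∀ j i, τ i ≤ η j i) ∧ ∀ i ω, Tendsto (fun j => η j i ω) atTop (nhds (τ i ω)) := by
  -- The first time is delayed to θ_j if necessary, and each later one only as far as the constraint
  -- requires. In the limit the maxima collapse to τ, which is already admissible for σ.
  let η : ℕ → Fin (k + 1) → Ω → WithTop ℝ≥0 := fun j =>
    Fin.induction (motive := fun _ => Ω → WithTop ℝ≥0) (fun ω => max (τ 0 ω) (θ j ω))
      fun i s ω => max (τ i.succ ω) (entryTime X (B i) s ω)
  have h0 : ∀ j, η j 0 = fun ω => max (τ 0 ω) (θ j ω) := fun j => rfl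
  have hs : ∀ j i, η j i.succ = fun ω => max (τ i.succ ω) (entryTime X (B i) (η j i.castSucc) ω) :=
    fun j i => rfl
  have hle : ∀ j i, τ i ≤ η j i := fun j i ω => by
    cases i using Fin.cases with
    | zero => rw [h0]; exact le_max_left _ _
    | succ i => rw [hs]; exact le_max_left _ _
  refine ⟨η, fun j => ⟨fun i => ?_, ?_, fun i ω => ?_⟩, hle, fun i ω => ?_⟩
  · induction i using Fin.induction with
    | zero => rw [h0]; exact (hτ.1 0).max (hθ j)
    | succ i ih => rw [hs]; exact (hτ.1 _).max (hB i ih)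
  · rw [h0]; exact fun ω => le_max_right _ _
  · rw [hs]; exact le_max_right _ _
  · induction i using Fin.induction with
    | zero =>
      simp only [h0]
      have h := (tendsto_const_nhds (x := τ 0 ω)).max (hlim ω)
      rwa [max_eq_left (hτ.2.1 ω)] at h
    | succ i ih =>
      simp only [hs]
      have h := (tendsto_const_nhds (x := τ i.succ ω)).max
        (tendsto_entryTime (X := X) (B := B i) (fun j => hle j i.castSucc ω) ih)
      rwa [max_eq_left (hτ.2.2 i ω)] at h

theorem IsReward.integrable_reward (hY : IsReward P F Y) {τ : Fin (k + 1) → Ω → WithTop ℝ≥0}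
    (hτ : τ ∈ strategies F X B σ) : Integrable (reward Y τ) P :=
  integrable_finsetSum _ fun i _ => hY.integrable_valueAt (hτ.1 i)

theorem IsReward.ae_reward (hY : IsReward P F Y) :
    ∀ᵐ ω ∂P, ∀ (σ : Ω → WithTop ℝ≥0), ∀ τ ∈ strategies F X B σ, 0 ≤ reward Y τ ω ∧
      ∀ T : ℝ≥0, T ≤ σ ω → reward Y τ ω ≤ (k + 1) * tailSup Y T ω := by
  filter_upwards [hY.ae_valueAt] with ω hω σ τ hτ
  refine ⟨Finset.sum_nonneg fun i _ => (hω (τ i)).1, fun T hT => ?_⟩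
  refine (Finset.sum_le_sum fun i _ => (hω (τ i)).2 T
    (hT.trans (le_of_mem_strategies hτ i ω))).trans ?_
  simp

variable [IsProbabilityMeasure P]

/-- Total rewards are dominated by (k + 1) times the supremum of Y and can be pasted along sets of
F_σ, so `exists_essSup_condExp` applies. -/
theorem exists_value (hY : IsReward P F Y) (hσ : IsStoppingTime F σ) :
    ∃ Z : Ω → ℝ, StronglyMeasurable[pastOf F σ] Z ∧ Integrable Z P ∧
      (∀ τ ∈ strategies F X B σ, P[reward Y τ | pastOf F σ] ≤ᵐ[P] Z) ∧
      ∃ τ : ℕ → Fin (k + 1) → Ω → WithTop ℝ≥0, (∀ n, τ n ∈ strategies F X B σ) ∧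
        (∀ᵐ ω ∂P, Tendsto (fun n => (P[reward Y (τ n) | pastOf F σ]) ω) atTop (nhds (Z ω))) ∧
        ∀ A, MeasurableSet[pastOf F σ] A →
          Tendsto (fun n => ∫ ω in A, reward Y (τ n) ω ∂P) atTop (nhds (∫ ω in A, Z ω ∂P)) := by
  classical
  obtain ⟨Z, h1, h2, h3, R, h4, h5, h6⟩ := exists_essSup_condExp (P := P) (pastOf_le F σ)
    (S := reward Y '' strategies F X B σ) (H := fun ω => (k + 1) * tailSup Y 0 ω)
    ⟨_, _, top_mem_strategies, rfl⟩ (by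
      rintro _ ⟨τ, hτ, rfl⟩
      exact hY.integrable_reward hτ) ((hY.integrable_tailSup 0).const_mul _) (by
      rintro _ ⟨τ, hτ, rfl⟩
      filter_upwards [hY.ae_reward] with ω hω
      exact (hω σ τ hτ).2 0 bot_le) (by
      rintro _ ⟨τ, hτ, rfl⟩ _ ⟨τ', hτ', rfl⟩ A hA
      refine ⟨_, ⟨_, piecewise_mem_strategies hσ hA hτ hτ', rfl⟩, ?_⟩
      ext ω
      by_cases hω : ω ∈ A
      · simp only [Pi.add_apply, indicator_of_mem hω, indicator_of_notMem (notMem_compl_iff.2 hω),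
          add_zero]
        exact Finset.sum_congr rfl fun i _ => valueAt_congr (piecewise_eq_of_mem _ _ _ hω)
      · simp only [Pi.add_apply, indicator_of_notMem hω, indicator_of_mem (mem_compl hω), zero_add]
        exact Finset.sum_congr rfl fun i _ => valueAt_congr (piecewise_eq_of_notMem _ _ _ hω))
  choose τ hτ hτR using h4
  refine ⟨Z, h1, h2, fun τ hτ => h3 _ ⟨τ, hτ, rfl⟩, τ, hτ, ?_, ?_⟩
  · simpa only [hτR] using h5
  · simpa only [hτR] using h6

theorem isEssSupFamily_multiValue (hY : IsReward P F Y) (hσ : IsStoppingTime F σ) :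
    IsEssSupFamily P (expectedRewards P F Y X B σ) (multiValue P F Y X B σ) := by
  obtain ⟨Z, h1, h2, h3, τ, h4, h5, -⟩ := exists_value (X := X) (B := B) hY hσ
  refine Classical.epsilon_spec (p := IsEssSupFamily P (expectedRewards P F Y X B σ))
    ⟨Z, h1.measurable.mono (pastOf_le F σ) le_rfl, ?_, fun V hV hle => ?_⟩
  · rintro _ ⟨τ, hτ, rfl⟩
    exact h3 τ hτ
  · have : ∀ᵐ ω ∂P, ∀ n, (P[reward Y (τ n) | pastOf F σ]) ω ≤ V ω :=
      ae_all_iff.2 fun n => hle _ ⟨τ n, h4 n, rfl⟩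
    filter_upwards [h5, this] with ω a b using le_of_tendsto' a b

/-- Since `multiValue` is picked by `Classical.epsilon`, only its defining property is available;
a.e. uniqueness transfers integrability and F_σ-measurability from a concrete version. -/
theorem multiValue_ae_eq (hY : IsReward P F Y) (hσ : IsStoppingTime F σ) {Z : Ω → ℝ}
    (hZ : Measurable Z) (hle : ∀ τ ∈ strategies F X B σ, P[reward Y τ | pastOf F σ] ≤ᵐ[P] Z)
    {τ : ℕ → Fin (k + 1) → Ω → WithTop ℝ≥0} (hτ : ∀ n, τ n ∈ strategies F X B σ)
    (hlim : ∀ᵐ ω ∂P, Tendsto (fun n => (P[reward Y (τ n) | pastOf F σ]) ω) atTop (nhds (Z ω))) :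
    multiValue P F Y X B σ =ᵐ[P] Z := by
  obtain ⟨h1, h2, h3⟩ := isEssSupFamily_multiValue (X := X) (B := B) hY hσ
  refine EventuallyLE.antisymm (h3 Z hZ ?_) ?_
  · rintro _ ⟨τ, hτ, rfl⟩
    exact hle τ hτ
  · have : ∀ᵐ ω ∂P, ∀ n, (P[reward Y (τ n) | pastOf F σ]) ω ≤ multiValue P F Y X B σ ω :=
      ae_all_iff.2 fun n => h2 _ ⟨τ n, hτ n, rfl⟩
    filter_upwards [hlim, this] with ω a b using le_of_tendsto' a b

/-- The value dominates all strategies and is approximated by strategies. -/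
theorem multiValue_spec (hY : IsReward P F Y) (hσ : IsStoppingTime F σ) :
    AEStronglyMeasurable[pastOf F σ] (multiValue P F Y X B σ) P ∧
      Integrable (multiValue P F Y X B σ) P ∧
      (∀ τ ∈ strategies F X B σ, ∀ A, MeasurableSet[pastOf F σ] A →
        ∫ ω in A, reward Y τ ω ∂P ≤ ∫ ω in A, multiValue P F Y X B σ ω ∂P) ∧
      ∃ τ : ℕ → Fin (k + 1) → Ω → WithTop ℝ≥0, (∀ n, τ n ∈ strategies F X B σ) ∧
        ∀ A, MeasurableSet[pastOf F σ] A → Tendsto (fun n => ∫ ω in A, reward Y (τ n) ω ∂P) atTop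
          (nhds (∫ ω in A, multiValue P F Y X B σ ω ∂P)) := by
  obtain ⟨Z, h1, h2, h3, τ, h4, h5, h6⟩ := exists_value (X := X) (B := B) hY hσ
  have hZ := multiValue_ae_eq hY hσ (h1.measurable.mono (pastOf_le F σ) le_rfl) h3 h4 h5
  have hint := h2.congr hZ.symm
  refine ⟨⟨Z, h1, hZ⟩, hint, fun τ hτ A hA => ?_, τ, h4, fun A hA => ?_⟩
  · exact setIntegral_le_of_condExp_le (pastOf_le F σ) (hY.integrable_reward hτ) hint
      ((h3 τ hτ).trans hZ.symm.le) hA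
  · rw [integral_congr_ae (ae_restrict_of_ae hZ)]
    exact h6 A hA

/-- A nearly optimal strategy for σ, replaced off A by never exercising, is a strategy for τ with
the same reward on A. -/
theorem setIntegral_multiValue_le_of_eq (hY : IsReward P F Y) (hσ : IsStoppingTime F σ)
    (hτ : IsStoppingTime F τ) {A : Set Ω} (hA : MeasurableSet[pastOf F σ] A)
    (h : ∀ ω ∈ A, σ ω = τ ω) :
    ∫ ω in A, multiValue P F Y X B σ ω ∂P ≤ ∫ ω in A, multiValue P F Y X B τ ω ∂P := by
  classical
  obtain ⟨-, -, -, θ, hθ, hlim⟩ := multiValue_spec (X := X) (B := B) hY hσ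
  obtain ⟨-, -, hle, -⟩ := multiValue_spec (X := X) (B := B) hY hτ
  refine le_of_tendsto' (hlim A hA) fun n => ?_
  refine le_trans (le_of_eq ?_) (hle _ (piecewise_top_mem_strategies hσ hA h (hθ n)) A
    (MeasurableSet.pastOf_of_subset_eq hσ hτ hA h))
  refine setIntegral_congr_fun (pastOf_le F σ _ hA) fun ω hω => ?_
  exact Finset.sum_congr rfl fun i _ => (valueAt_congr (piecewise_eq_of_mem A _ _ hω)).symm

theorem multiValue_le_of_eq (hY : IsReward P F Y) (hσ : IsStoppingTime F σ)
    (hτ : IsStoppingTime F τ) :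
    ∀ᵐ ω ∂P, σ ω = τ ω → multiValue P F Y X B σ ω ≤ multiValue P F Y X B τ ω := by
  obtain ⟨hm, hi, -⟩ := multiValue_spec (X := X) (B := B) hY hσ
  obtain ⟨hm', hi', -⟩ := multiValue_spec (X := X) (B := B) hY hτ
  have hD := measurableSet_pastOf_eq hσ hτ
  have hDm := pastOf_le F σ _ hD
  have key : {ω | σ ω = τ ω}.indicator (multiValue P F Y X B σ) ≤ᵐ[P]
      {ω | σ ω = τ ω}.indicator (multiValue P F Y X B τ) := by
    refine ae_le_of_setIntegral_le (pastOf_le F σ) (hi.indicator hDm) (hi'.indicator hDm)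
      ?_ ?_ fun A hA => ?_
    · obtain ⟨g, hg, hgeq⟩ := hm
      exact ⟨_, hg.indicator hD, hgeq.indicator⟩
    · obtain ⟨g, hg, hgeq⟩ := hm'
      refine ⟨{ω | σ ω = τ ω}.indicator g, ?_, ?_⟩
      · have hD' := MeasurableSet.pastOf_of_subset_eq hσ hτ hD fun _ => id
        -- The version g is measurable for the past of τ; cut off outside {σ = τ}, it is measurable
        -- for the past of σ, since the traces coincide.
        refine (hg.indicator hD').stronglyMeasurable_of_measurableSpace_le_on hD'
          (fun t ht => ?_) fun ω hω => indicator_of_notMem hω _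
        exact MeasurableSet.pastOf_of_subset_eq hτ hσ ht fun _ h => h.1.symm
      · filter_upwards [hgeq] with ω hω
        by_cases h : σ ω = τ ω <;> simp [h, hω]
    · rw [setIntegral_indicator hDm, setIntegral_indicator hDm]
      exact setIntegral_multiValue_le_of_eq hY hσ hτ (hA.inter hD) fun _ h => h.2
  filter_upwards [key] with ω hω h
  simpa [h] using hω

/-- The value of the multiple stopping problem is a regular family. -/
theorem regularFamily_multiValue (hY : IsReward P F Y)
    (hB : ∀ (i : Fin k) {τ}, IsStoppingTime F τ → IsStoppingTime F (entryTime X (B i) τ)) :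
    RegularFamily P F Y (k + 1) (multiValue P F Y X B) where
  const_nonneg := by positivity
  integrable hσ := (multiValue_spec hY hσ).2.1
  meas hσ := (multiValue_spec hY hσ).1
  super {σ τ} hσ hτ h A hA := by
    obtain ⟨-, -, hle, -⟩ := multiValue_spec (X := X) (B := B) hY hσ
    obtain ⟨-, -, -, θ, hθ, hlim⟩ := multiValue_spec (X := X) (B := B) hY hτ
    exact le_of_tendsto' (hlim A (pastOf_mono hσ hτ h _ hA)) fun n =>
      hle _ (strategies_antitone h (hθ n)) A hA
  rightCont {σ θ} hσ hθ hle hlim A hA := by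
    obtain ⟨-, -, hσle, τ, hτ, hτlim⟩ := multiValue_spec (X := X) (B := B) hY hσ
    have hup : ∀ j, ∫ ω in A, multiValue P F Y X B (θ j) ω ∂P ≤
        ∫ ω in A, multiValue P F Y X B σ ω ∂P := fun j => by
      obtain ⟨-, -, -, η, hη, hlim⟩ := multiValue_spec (X := X) (B := B) hY (hθ j)
      exact le_of_tendsto' (hlim A (pastOf_mono hσ (hθ j) (hle j) _ hA)) fun n =>
        hσle _ (strategies_antitone (hle j) (hη n)) A hA
    -- The upper bound holds for all j because strategies for θ_j are strategies for σ. For the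
    -- lower bound a nearly optimal strategy for σ is shifted to start at θ_j, and its rewards
    -- converge by right-continuity of Y.
    refine tendsto_order.2 ⟨fun c hc => ?_, fun c hc => Eventually.of_forall fun j =>
      (hup j).trans_lt hc⟩
    obtain ⟨n, hn⟩ := ((hτlim A hA).eventually_const_lt hc).exists
    obtain ⟨η, hη, hτη, hηlim⟩ := exists_strategies_tendsto hB hθ hlim (hτ n)
    have hconv : Tendsto (fun j => ∫ ω in A, reward Y (η j) ω ∂P) atTop
        (nhds (∫ ω in A, reward Y (τ n) ω ∂P)) := by
      refine tendsto_integral_of_dominated_convergence (fun ω => (k + 1) * tailSup Y 0 ω)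
        (fun j => (hY.integrable_reward (hη j)).1.restrict)
        ((hY.integrable_tailSup 0).const_mul _).integrableOn
        (fun j => ae_restrict_of_ae ?_) (Eventually.of_forall fun ω => ?_)
      · filter_upwards [hY.ae_reward] with ω hω
        rw [Real.norm_of_nonneg (hω _ _ (hη j)).1]
        exact (hω _ _ (hη j)).2 0 bot_le
      · exact tendsto_finsetSum _ fun i _ =>
          tendsto_valueAt (hY.right ω) (fun j => hτη j i ω) (hηlim i ω)
    refine (hconv.eventually_const_lt hn).mono fun j hj => hj.trans_le ?_
    exact (multiValue_spec hY (hθ j)).2.2.1 _ (hη j) A (pastOf_mono hσ (hθ j) (hle j) _ hA)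
  congr {σ τ} hσ hτ := by
    filter_upwards [multiValue_le_of_eq hY hσ hτ, multiValue_le_of_eq hY hτ hσ] with ω h1 h2 h
    exact le_antisymm (h1 h) (h2 h.symm)
  lower {σ} hσ A hA := by
    refine le_trans (le_of_eq ?_) ((multiValue_spec hY hσ).2.2.1 _ top_mem_strategies A hA)
    refine integral_congr_ae (Eventually.of_forall fun ω => ?_)
    have : ∀ i ∈ Finset.univ, valueAt Y ((fun _ _ => ⊤ : Fin (k + 1) → Ω → WithTop ℝ≥0) i) ω =
        limitValue Y ω := fun i _ => valueAt_of_eq_top rfl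
    rw [reward, Finset.sum_congr rfl this]
    simp
  upper {σ} hσ T hT A hA := by
    obtain ⟨-, -, -, τ, hτ, hlim⟩ := multiValue_spec (X := X) (B := B) hY hσ
    refine le_of_tendsto' (hlim A hA) fun n => ?_
    refine setIntegral_mono_ae (hY.integrable_reward (hτ n)).integrableOn
      ((hY.integrable_tailSup T).const_mul _).integrableOn ?_
    filter_upwards [hY.ae_reward] with ω hω
    exact (hω _ _ (hτ n)).2 T (hT ω)

end Value

/-! ### Paths without infinitely many dyadic upcrossings -/

/-- The multiples of `2⁻ⁿ`. -/
def grid (n : ℕ) : Set ℝ≥0 := range fun i : ℕ => (i : ℝ≥0) / 2 ^ n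

/-- The dyadic rationals. -/
def dyadics : Set ℝ≥0 := ⋃ n, grid n

theorem grid_subset_dyadics (n : ℕ) : grid n ⊆ dyadics := subset_iUnion grid n

theorem grid_mono : Monotone grid := by
  refine monotone_nat_of_le_succ fun n => ?_
  rintro _ ⟨i, rfl⟩
  refine ⟨2 * i, ?_⟩
  push_cast
  rw [pow_succ, mul_comm (2 ^ n) 2, mul_div_mul_left _ _ two_ne_zero]

theorem countable_dyadics : dyadics.Countable := countable_iUnion fun _ => countable_range _

theorem dyadicUp_mem (j : ℕ) (t : ℝ≥0) : dyadicUp j t ∈ dyadics :=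
  grid_subset_dyadics j ⟨_, rfl⟩

theorem natCast_mem_dyadics (n : ℕ) : (n : ℝ≥0) ∈ dyadics :=
  grid_subset_dyadics 0 ⟨n, by simp⟩

/-- The path `f` has `N` upcrossings of `[a, b]` along `D` before `v`. -/
def HasUpcrossings (D : Set ℝ≥0) (f : ℝ≥0 → ℝ) (a b : ℝ) : ℕ → ℝ≥0 → Prop
  | 0, _ => True
  | N + 1, v => ∃ s ∈ D, ∃ t ∈ D, s < t ∧ t < v ∧ f s < a ∧ b < f t ∧ HasUpcrossings D f a b N s

namespace HasUpcrossings

variable {D D' : Set ℝ≥0} {f : ℝ≥0 → ℝ} {a b : ℝ}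

theorem mono {N : ℕ} {v v' : ℝ≥0} (hD : D ⊆ D') (hv : v ≤ v')
    (h : HasUpcrossings D f a b N v) : HasUpcrossings D' f a b N v' := by
  induction N generalizing v v' with
  | zero => trivial
  | succ N ih =>
    obtain ⟨s, hs, t, ht, h1, h2, h3, h4, h5⟩ := h
    exact ⟨s, hD hs, t, hD ht, h1, h2.trans_le hv, h3, h4, ih le_rfl h5⟩

theorem exists_grid {N : ℕ} {v : ℝ≥0} (h : HasUpcrossings dyadics f a b N v) :
    ∃ n, HasUpcrossings (grid n) f a b N v := by
  induction N generalizing v with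
  | zero => exact ⟨0, trivial⟩
  | succ N ih =>
    obtain ⟨s, hs, t, ht, h1, h2, h3, h4, h5⟩ := h
    obtain ⟨n1, hn1⟩ := mem_iUnion.1 hs
    obtain ⟨n2, hn2⟩ := mem_iUnion.1 ht
    obtain ⟨n3, hn3⟩ := ih h5
    refine ⟨max n1 (max n2 n3), s, grid_mono (le_max_left _ _) hn1, t,
      grid_mono ((le_max_left _ _).trans (le_max_right _ _)) hn2, h1, h2, h3, h4,
      hn3.mono (grid_mono ((le_max_right _ _).trans (le_max_right _ _))) le_rfl⟩

/-- Counting from the last pair backwards, a pair with grid indices i < j adds one to the count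
before i and is complete by index j + 1 ≤ M. -/
theorem le_upcrossingsBefore {Ω : Type*} {U : ℝ≥0 → Ω → ℝ} {ω : Ω} (hab : a < b) {n N : ℕ}
    {v : ℝ≥0} (h : HasUpcrossings (grid n) (fun t => U t ω) a b N v) {M : ℕ}
    (hv : v ≤ (M : ℝ≥0) / 2 ^ n) :
    N ≤ upcrossingsBefore a b (fun (i : ℕ) ω => U ((i : ℝ≥0) / 2 ^ n) ω) M ω := by
  induction N generalizing v M with
  | zero => exact Nat.zero_le _
  | succ N ih =>
    obtain ⟨_, ⟨i, rfl⟩, _, ⟨j, rfl⟩, h1, h2, h3, h4, h5⟩ := h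
    have hcast : ∀ {p q : ℕ}, (p : ℝ≥0) / 2 ^ n < (q : ℝ≥0) / 2 ^ n → p < q := fun {p q} h => by
      rw [div_lt_div_iff_of_pos_right (by positivity)] at h
      exact_mod_cast h
    have hij : i < j := hcast h1
    have hjM : j < M := hcast (h2.trans_le hv)
    calc N + 1 ≤ upcrossingsBefore a b (fun (i : ℕ) ω => U ((i : ℝ≥0) / 2 ^ n) ω) i ω + 1 :=
          Nat.succ_le_succ (ih h5 le_rfl)
      _ ≤ upcrossingsBefore a b (fun (i : ℕ) ω => U ((i : ℝ≥0) / 2 ^ n) ω) (j + 1) ω :=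
          upcrossingsBefore_lt_of_exists_upcrossing hab le_rfl h3 hij.le h4
      _ ≤ _ := upcrossingsBefore_mono hab (Nat.succ_le_of_lt hjM) ω

end HasUpcrossings

/-- Paths that are bounded along the dyadic rationals and have finitely many dyadic upcrossings of
any rational interval. -/
structure IsRegularPath (f : ℝ≥0 → ℝ) : Prop where
  bdd : ∃ C, ∀ q ∈ dyadics, |f q| ≤ C
  upcrossings : ∀ a b : ℚ, a < b → ∃ N, ∀ v, ¬ HasUpcrossings dyadics f a b N v

namespace IsRegularPath

variable {f g : ℝ≥0 → ℝ}

theorem exists_tendsto (hf : IsRegularPath f) {l : Filter ℝ≥0} (hl : dyadics ∈ l)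
    (hup : ∀ a b : ℝ, (∃ᶠ t in l, f t < a) → (∃ᶠ t in l, b < f t) →
      ∀ N, ∃ v, HasUpcrossings dyadics f a b N v) : ∃ x, Tendsto f l (nhds x) := by
  obtain ⟨C, hC⟩ := hf.bdd
  refine tendsto_of_no_upcrossings (Rat.denseRange_cast (𝕜 := ℝ)) ?_ ?_ ?_
  · rintro _ ⟨a, rfl⟩ _ ⟨b, rfl⟩ hab ⟨h1, h2⟩
    obtain ⟨N, hN⟩ := hf.upcrossings a b (by exact_mod_cast hab)
    obtain ⟨v, hv⟩ := hup a b h1 h2 N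
    exact hN v hv
  · exact isBoundedUnder_of_eventually_le (a := C)
      (by filter_upwards [hl] with q hq using (abs_le.1 (hC q hq)).2)
  · exact isBoundedUnder_of_eventually_ge (a := -C)
      (by filter_upwards [hl] with q hq using (abs_le.1 (hC q hq)).1)

/-- If f oscillated at t+, pairs could be chosen downwards, each between t and the previous pair.
The induction is therefore over all v > t at once. -/
theorem exists_right_limit (hf : IsRegularPath f) (t : ℝ≥0) :
    ∃ x, Tendsto f (nhdsWithin t (dyadics ∩ Ioi t)) (nhds x) := by
  refine hf.exists_tendsto (mem_of_superset self_mem_nhdsWithin inter_subset_left)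
    fun a b h1 h2 N => ?_
  have key : ∀ N, ∀ v > t, HasUpcrossings dyadics f a b N v := fun N => by
    induction N with
    | zero => exact fun _ _ => trivial
    | succ N ih =>
      intro v hv
      have hev : ∀ w > t, ∀ᶠ q in nhdsWithin t (dyadics ∩ Ioi t), q ∈ dyadics ∧ t < q ∧ q < w :=
        fun w hw => by
          filter_upwards [self_mem_nhdsWithin, mem_nhdsWithin_of_mem_nhds (Iio_mem_nhds hw)]
            with q h1 h2 using ⟨h1.1, h1.2, h2⟩
      obtain ⟨r, hr, hrD, htr, hrv⟩ := (h2.and_eventually (hev v hv)).exists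
      obtain ⟨s, hs, hsD, hts, hsr⟩ := (h1.and_eventually (hev r htr)).exists
      exact ⟨s, hsD, r, hrD, hsr, hrv, hs, hr, ih s hts⟩
  exact ⟨t + 1, key N _ (lt_add_one t)⟩

/-- Here pairs are appended to the right, beyond the horizon v of the earlier ones. -/
theorem exists_limit_atTop (hf : IsRegularPath f) :
    ∃ x, Tendsto f (atTop ⊓ 𝓟 dyadics) (nhds x) := by
  refine hf.exists_tendsto (mem_inf_of_right (mem_principal_self _)) fun a b h1 h2 N => ?_
  induction N with
  | zero => exact ⟨0, trivial⟩
  | succ N ih =>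
    obtain ⟨v, hv⟩ := ih
    have hev : ∀ w, ∀ᶠ q in atTop ⊓ 𝓟 dyadics, q ∈ dyadics ∧ w < q := fun w => by
      filter_upwards [mem_inf_of_right (mem_principal_self _),
        mem_inf_of_left (Ioi_mem_atTop w)] with q h1 h2 using ⟨h1, h2⟩
    obtain ⟨s, hs, hsD, hvs⟩ := (h1.and_eventually (hev v)).exists
    obtain ⟨r, hr, hrD, hsr⟩ := (h2.and_eventually (hev s)).exists
    exact ⟨r + 1, s, hsD, r, hrD, hsr, lt_add_one r, hs, hr, hv.mono subset_rfl hvs.le⟩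

end IsRegularPath

theorem tendsto_dyadicUp_nhdsWithin (t : ℝ≥0) :
    Tendsto (fun j => dyadicUp j t) atTop (nhdsWithin t (dyadics ∩ Ioi t)) :=
  tendsto_nhdsWithin_iff.2
    ⟨tendsto_dyadicUp t, Eventually.of_forall fun j => ⟨dyadicUp_mem j t, lt_dyadicUp j t⟩⟩

/-- Right limits along the dyadic rationals form a right-continuous function. -/
theorem continuousWithinAt_of_right_limits {f g : ℝ≥0 → ℝ}
    (h : ∀ t, Tendsto f (nhdsWithin t (dyadics ∩ Ioi t)) (nhds (g t))) (t : ℝ≥0) :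
    ContinuousWithinAt g (Ici t) t := by
  refine Metric.tendsto_nhds.2 fun ε hε => ?_
  have h1 := Metric.tendsto_nhds.1 (h t) (ε / 2) (half_pos hε)
  rw [eventually_nhdsWithin_iff] at h1
  have h2 : ∀ᶠ s in nhds t, ∀ᶠ q in nhds s, q ∈ dyadics ∩ Ioi t → dist (f q) (g t) < ε / 2 :=
    eventually_eventually_nhds.2 h1
  filter_upwards [mem_nhdsWithin_of_mem_nhds h2, self_mem_nhdsWithin] with s hs hts
  have hlim : Tendsto (fun j => dist (f (dyadicUp j s)) (g t)) atTop (nhds (dist (g s) (g t))) :=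
    ((h s).comp (tendsto_dyadicUp_nhdsWithin s)).dist tendsto_const_nhds
  refine lt_of_le_of_lt (le_of_tendsto hlim ?_) (half_lt_self hε)
  filter_upwards [(tendsto_dyadicUp s).eventually hs] with j hj
  exact (hj ⟨dyadicUp_mem j s, lt_of_le_of_lt hts (lt_dyadicUp j s)⟩).le

theorem tendsto_atTop_of_dyadics {f g : ℝ≥0 → ℝ} {x : ℝ}
    (hg : ∀ t, ContinuousWithinAt g (Ici t) t) (hfg : ∀ q ∈ dyadics, g q = f q)
    (h : Tendsto f (atTop ⊓ 𝓟 dyadics) (nhds x)) : Tendsto g atTop (nhds x) := by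
  refine Metric.tendsto_nhds.2 fun ε hε => ?_
  have h1 := Metric.tendsto_nhds.1 h (ε / 2) (half_pos hε)
  rw [eventually_inf_principal] at h1
  obtain ⟨T, hT⟩ := eventually_atTop.1 h1
  filter_upwards [eventually_ge_atTop T] with t ht
  have hlim : Tendsto (fun j => dist (g (dyadicUp j t)) x) atTop (nhds (dist (g t) x)) :=
    (tendsto_comp_dyadicUp hg t).dist tendsto_const_nhds
  refine lt_of_le_of_lt (le_of_tendsto' hlim fun j => ?_) (half_lt_self hε)
  rw [hfg _ (dyadicUp_mem j t)]
  exact (hT _ (ht.trans (lt_dyadicUp j t).le) (dyadicUp_mem j t)).le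

/-! ### Regularity of the paths of supermartingales -/

section Supermartingale

variable {Ω : Type*} {m : MeasurableSpace Ω} {P : Measure Ω} {F : Filtration ℝ≥0 m}

/-- The restriction of a filtration to the multiples of `2⁻ⁿ`. -/
noncomputable def gridFiltration (F : Filtration ℝ≥0 m) (n : ℕ) : Filtration ℕ m where
  seq i := F ((i : ℝ≥0) / 2 ^ n)
  mono' i j h := F.mono (by gcongr)
  le' i := F.le _

theorem submartingale_grid {U : ℝ≥0 → Ω → ℝ} (hU : Submartingale U F P) (n : ℕ) :
    Submartingale (fun i : ℕ => U ((i : ℝ≥0) / 2 ^ n)) (gridFiltration F n) P :=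
  ⟨fun i => hU.1 _, fun i j h => hU.2.1 _ _ (by gcongr), fun i => hU.2.2 _⟩

variable [IsProbabilityMeasure P]

/-- The bound C/N is uniform in n, so it survives the increasing union over n. -/
theorem measure_iInter_iUnion_eq_zero {S : ℕ → ℕ → Set Ω} (hS : ∀ N, Monotone (S N)) {C : ℝ}
    (hC : ∀ N n, N * P.real (S N n) ≤ C) : P (⋂ N, ⋃ n, S N n) = 0 := by
  have h1 : ∀ N : ℕ, P (⋂ N, ⋃ n, S N n) ≤ ENNReal.ofReal (C / (N + 1)) := fun N => by
    refine (measure_mono (iInter_subset _ (N + 1))).trans ?_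
    rw [(hS (N + 1)).measure_iUnion]
    refine iSup_le fun n => ?_
    rw [← ofReal_measureReal]
    refine ENNReal.ofReal_le_ofReal ?_
    rw [le_div_iff₀ (by positivity), mul_comm]
    exact_mod_cast hC (N + 1) n
  have h2 : Tendsto (fun N : ℕ => ENNReal.ofReal (C / (N + 1))) atTop (nhds 0) := by
    have := ENNReal.tendsto_ofReal (tendsto_const_div_atTop_nhds_zero_nat C |>.comp
      (tendsto_add_atTop_nat 1))
    simpa using this
  exact le_antisymm (ge_of_tendsto' h2 h1) bot_le

/-- Since U ≤ 0, the expected positive part of U - a is at most |a| at every time, so the upcrossing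
inequality is uniform in mesh and horizon. Both are refined together: mesh 2⁻ⁿ up to time n, that is
n·2ⁿ steps. -/
theorem ae_upcrossings {U : ℝ≥0 → Ω → ℝ} (hU : Submartingale U F P) (hneg : ∀ t, U t ≤ᵐ[P] 0)
    {a b : ℝ} (hab : a < b) :
    ∀ᵐ ω ∂P, ∃ N, ∀ v, ¬ HasUpcrossings dyadics (fun t => U t ω) a b N v := by
  have hmeas : P (⋂ N, ⋃ n : ℕ, {ω | HasUpcrossings (grid n) (fun t => U t ω) a b N n}) = 0 := by
    refine measure_iInter_iUnion_eq_zero (C := |a| / (b - a)) (fun N n n' h ω hω =>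
      HasUpcrossings.mono (grid_mono h) (by exact_mod_cast h) hω) fun N n => ?_
    set g : ℕ → Ω → ℝ := fun i ω => U ((i : ℝ≥0) / 2 ^ n) ω
    have hg : Submartingale g (gridFiltration F n) P := submartingale_grid hU n
    have h1 := mul_meas_ge_le_integral_of_nonneg (μ := P)
      (f := fun ω => (upcrossingsBefore a b g (n * 2 ^ n) ω : ℝ))
      (Eventually.of_forall fun ω => Nat.cast_nonneg _)
      (hg.1.integrable_upcrossingsBefore hab) N
    have h2 := hg.mul_integral_upcrossingsBefore_le_integral_pos_part a b (n * 2 ^ n)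
    have h3 : ∫ ω, (g (n * 2 ^ n) ω - a)⁺ ∂P ≤ |a| := by
      have : ∫ ω, (g (n * 2 ^ n) ω - a)⁺ ∂P ≤ ∫ _, |a| ∂P := by
        refine integral_mono_of_nonneg (Eventually.of_forall fun ω => posPart_nonneg _)
          (integrable_const _) ?_
        filter_upwards [hneg (((n * 2 ^ n : ℕ) : ℝ≥0) / 2 ^ n)] with ω hω
        refine sup_le ?_ (abs_nonneg a)
        have : g (n * 2 ^ n) ω ≤ 0 := hω
        linarith [neg_abs_le a]
      simpa using this
    refine (mul_le_mul_of_nonneg_left (measureReal_mono fun ω hω => ?_)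
      (Nat.cast_nonneg N)).trans (h1.trans ?_)
    · refine Nat.cast_le (α := ℝ) |>.2 (HasUpcrossings.le_upcrossingsBefore hab hω ?_)
      push_cast
      rw [mul_div_cancel_right₀ _ (by positivity)]
    · rw [le_div_iff₀ (sub_pos.2 hab), mul_comm]
      exact h2.trans h3
  filter_upwards [measure_eq_zero_iff_ae_notMem.1 hmeas] with ω hω
  by_contra! h
  refine hω (mem_iInter.2 fun N => ?_)
  obtain ⟨v, hv⟩ := h N
  obtain ⟨n, hn⟩ := hv.exists_grid
  obtain ⟨p, hp⟩ := exists_nat_ge v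
  refine mem_iUnion.2 ⟨max n p, hn.mono (grid_mono (le_max_left _ _)) (hp.trans ?_)⟩
  exact_mod_cast le_max_right n p

/-- Doob's maximal inequality on the grids bounds N times the probability of reaching level N by C,
whatever the mesh and the horizon. -/
theorem ae_bddAbove_dyadics {U : ℝ≥0 → Ω → ℝ} (hU : Submartingale U F P) (h0 : ∀ t ω, 0 ≤ U t ω)
    {C : ℝ} (hC : ∀ t, ∫ ω, U t ω ∂P ≤ C) :
    ∀ᵐ ω ∂P, ∃ N : ℕ, ∀ q ∈ dyadics, U q ω ≤ N := by
  have hmeas : P (⋂ N : ℕ, ⋃ n : ℕ, {ω | ∃ q ∈ grid n, q ≤ n ∧ (N : ℝ) ≤ U q ω}) = 0 := by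
    refine measure_iInter_iUnion_eq_zero (C := C) (fun N n n' h ω => ?_) fun N n => ?_
    · rintro ⟨q, hq, hqn, hqN⟩
      exact ⟨q, grid_mono h hq, hqn.trans (by exact_mod_cast h), hqN⟩
    set g : ℕ → Ω → ℝ := fun i ω => U ((i : ℝ≥0) / 2 ^ n) ω
    have hg : Submartingale g (gridFiltration F n) P := submartingale_grid hU n
    have h1 := maximal_ineq hg (fun i ω => h0 _ _) (ε := (N : ℝ≥0)) (n * 2 ^ n)
    set A := {ω | (((N : ℝ≥0) : ℝ≥0) : ℝ) ≤ (Finset.range (n * 2 ^ n + 1)).sup'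
      Finset.nonempty_range_add_one fun k => g k ω}
    have h2 : ∫ ω in A, g (n * 2 ^ n) ω ∂P ≤ C :=
      (setIntegral_le_integral (hg.integrable _) (Eventually.of_forall fun ω => h0 _ _)).trans
        (hC _)
    have h3 : (N : ℝ) * P.real A ≤ C := by
      have hC0 : 0 ≤ C := (integral_nonneg fun ω => h0 0 ω).trans (hC 0)
      have := ENNReal.toReal_mono ENNReal.ofReal_ne_top (h1.trans (ENNReal.ofReal_le_ofReal h2))
      rw [ENNReal.toReal_mul, ENNReal.toReal_ofReal hC0] at this
      simpa [Measure.real] using this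
    refine (mul_le_mul_of_nonneg_left (measureReal_mono ?_) (Nat.cast_nonneg N)).trans h3
    rintro ω ⟨_, ⟨i, rfl⟩, hin, hiN⟩
    refine le_trans (by simpa using hiN) (Finset.le_sup' (fun k => g k ω) (b := i) ?_)
    rw [Finset.mem_range, Nat.lt_succ_iff]
    rw [div_le_iff₀ (by positivity)] at hin
    exact_mod_cast hin
  filter_upwards [measure_eq_zero_iff_ae_notMem.1 hmeas] with ω hω
  by_contra! h
  refine hω (mem_iInter.2 fun N => ?_)
  obtain ⟨q, hq, hqN⟩ := h N
  obtain ⟨n, hn⟩ := mem_iUnion.1 hq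
  obtain ⟨p, hp⟩ := exists_nat_ge q
  refine mem_iUnion.2 ⟨max n p, q, grid_mono (le_max_left _ _) hn, hp.trans ?_, hqN.le⟩
  exact_mod_cast le_max_right n p

/-- Almost all paths of a non-negative supermartingale that is dominated by a martingale
`E(H | F_t)` are regular along the dyadic rationals. -/
theorem ae_isRegularPath_neg {U : ℝ≥0 → Ω → ℝ} (hU : Supermartingale U F P)
    (h0 : ∀ t, 0 ≤ᵐ[P] U t) {H : Ω → ℝ} (hUH : ∀ t, U t ≤ᵐ[P] P[H | F t]) :
    ∀ᵐ ω ∂P, IsRegularPath fun t => -U t ω := by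
  have hup : ∀ᵐ ω ∂P, ∀ a b : ℚ, a < b →
      ∃ N, ∀ v, ¬ HasUpcrossings dyadics (fun t => -U t ω) a b N v := by
    refine ae_all_iff.2 fun a => ae_all_iff.2 fun b => ?_
    by_cases hab : a < b
    · have := ae_upcrossings (a := a) (b := b) hU.neg (fun t => ?_) (by exact_mod_cast hab)
      · filter_upwards [this] with ω hω _ using hω
      · filter_upwards [h0 t] with ω hω using neg_nonpos.2 hω
    · exact Eventually.of_forall fun ω h => absurd h hab
  -- The maximal inequality needs an everywhere non-negative submartingale; the positive part of the
  -- dominating martingale is one.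
  have hM := (martingale_condExp H F P).submartingale.pos
  have hbdd := ae_bddAbove_dyadics (C := ∫ ω, |H ω| ∂P) hM (fun t ω => posPart_nonneg _) fun t => by
    refine le_trans (integral_mono_of_nonneg (Eventually.of_forall fun ω => posPart_nonneg _)
      (integrable_condExp (m := F t) (f := H)).abs (Eventually.of_forall fun ω => ?_)) (integral_abs_condExp_le (m := F t) H)
    exact sup_le (le_abs_self _) (abs_nonneg _)
  have hq : ∀ᵐ ω ∂P, ∀ q ∈ dyadics, 0 ≤ U q ω ∧ U q ω ≤ (P[H | F q]) ω := by
    refine (ae_ball_iff countable_dyadics).2 fun q _ => ?_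
    filter_upwards [h0 q, hUH q] with ω h1 h2 using ⟨h1, h2⟩
  filter_upwards [hup, hbdd, hq] with ω h1 ⟨N, h2⟩ h3
  refine ⟨⟨N, fun q hq => ?_⟩, h1⟩
  rw [abs_neg, abs_of_nonneg (h3 q hq).1]
  exact ((h3 q hq).2.trans le_sup_left).trans (h2 q hq)

end Supermartingale

/-! ### Right-continuous modifications of regular families -/

section Modification

variable {Ω : Type*} {m : MeasurableSpace Ω} {P : Measure Ω} {F : Filtration ℝ≥0 m}

theorem MeasurableSet.of_forall_gt [hF : F.IsRightContinuous] {t : ℝ≥0} {A : Set Ω}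
    (h : ∀ s > t, MeasurableSet[F s] A) : MeasurableSet[F t] A := by
  refine hF.RC t _ ?_
  rw [Filtration.rightCont_eq]
  simp only [MeasurableSpace.measurableSet_iInf]
  exact h

/-- Only measurable null sets are known to lie in F_0, hence the requirement that f be measurable
for the ambient σ-algebra. -/
theorem measurable_of_ae_eq_of_null
    (hF_null : ∀ N : Set Ω, MeasurableSet N → P N = 0 → MeasurableSet[F 0] N) {t : ℝ≥0}
    {f g : Ω → ℝ} (hf : Measurable f) (hg : Measurable[F t] g) (h : f =ᵐ[P] g) :
    Measurable[F t] f := by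
  have hN : MeasurableSet {ω | f ω ≠ g ω} :=
    (measurableSet_eq_fun hf (hg.mono (F.le t) le_rfl)).compl
  have hN0 : P {ω | f ω ≠ g ω} = 0 := h
  have hnull : ∀ N : Set Ω, MeasurableSet N → P N = 0 → MeasurableSet[F t] N := fun N h1 h2 =>
    F.mono (zero_le) _ (hF_null N h1 h2)
  intro s hs
  have : f ⁻¹' s = (g ⁻¹' s \ {ω | f ω ≠ g ω}) ∪ (f ⁻¹' s ∩ {ω | f ω ≠ g ω}) := by
    ext ω
    by_cases hω : f ω = g ω <;> simp [hω]
  rw [this]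
  refine ((hg hs).diff (hnull _ hN hN0)).union (hnull _ ((hf hs).inter hN) ?_)
  exact measure_mono_null inter_subset_right hN0

variable [IsProbabilityMeasure P] {Y : ℝ≥0 → Ω → ℝ} {c : ℝ} {W : (Ω → WithTop ℝ≥0) → Ω → ℝ}
  {U V : ℝ≥0 → Ω → ℝ}

theorem iSup_natCast (F : Filtration ℝ≥0 m) : ⨆ n : ℕ, F (n : ℝ≥0) = ⨆ t, F t := by
  refine le_antisymm (iSup_le fun n => le_iSup (fun t => F t) (n : ℝ≥0)) (iSup_le fun t => ?_)
  obtain ⟨n, hn⟩ := exists_nat_ge t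
  exact (F.mono hn).trans (le_iSup (fun n : ℕ => F (n : ℝ≥0)) n)

/-- Lévy's upward theorem along the integer times of a filtration indexed by `ℝ≥0`. -/
theorem ae_tendsto_condExp_natCast {f : Ω → ℝ} (hf : Integrable f P)
    (hfm : AEStronglyMeasurable[⨆ t, F t] f P) :
    ∀ᵐ ω ∂P, Tendsto (fun n : ℕ => (P[f | F (n : ℝ≥0)]) ω) atTop (nhds (f ω)) := by
  let G : Filtration ℕ m := ⟨fun n => F (n : ℝ≥0), fun i j h => F.mono (by exact_mod_cast h),
    fun n => F.le _⟩
  have h1 := MeasureTheory.tendsto_ae_condExp (μ := P) (ℱ := G) f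
  have h2 : P[f | ⨆ n, G n] =ᵐ[P] f := by
    have : ⨆ n, G n = ⨆ t, F t := iSup_natCast F
    rw [this]
    exact condExp_of_aestronglyMeasurable' (iSup_le fun t => F.le t) hfm hf
  filter_upwards [h1, h2] with ω a b
  rwa [b] at a

namespace RegularFamily

theorem supermartingale (h : RegularFamily P F Y c W) (hUm : StronglyAdapted F U)
    (hU : ∀ t : ℝ≥0, U t =ᵐ[P] W fun _ => t) : Supermartingale U F P := by
  have hint : ∀ t, Integrable (U t) P := fun t =>
    (h.integrable (isStoppingTime_const F t)).congr (hU t).symm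
  refine ⟨hUm, fun s t hst => ?_, hint⟩
  refine condExp_le_of_setIntegral_le (F.le s) (hint t) (hint s)
    (hUm s).aestronglyMeasurable fun A hA => ?_
  rw [integral_congr_ae (ae_restrict_of_ae (hU s)), integral_congr_ae (ae_restrict_of_ae (hU t))]
  rw [← pastOf_const] at hA
  exact h.super (isStoppingTime_const F s) (isStoppingTime_const F t)
    (fun _ => WithTop.coe_le_coe.2 hst) A hA

theorem process_nonneg (h : RegularFamily P F Y c W) (hY : IsReward P F Y)
    (hU : ∀ t : ℝ≥0, U t =ᵐ[P] W fun _ => t) (t : ℝ≥0) : 0 ≤ᵐ[P] U t :=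
  (h.nonneg hY (isStoppingTime_const F t)).trans (hU t).symm.le

theorem process_le (h : RegularFamily P F Y c W) (hY : IsReward P F Y)
    (hU : ∀ t : ℝ≥0, U t =ᵐ[P] W fun _ => t) {T t : ℝ≥0} (hT : T ≤ t) :
    U t ≤ᵐ[P] P[fun ω => c * tailSup Y T ω | F t] := by
  have := (hU t).le.trans (h.le_condExp hY (isStoppingTime_const F t) (T := T)
    fun _ => WithTop.coe_le_coe.2 hT)
  rwa [pastOf_const] at this

theorem ae_isRegularPath (h : RegularFamily P F Y c W) (hY : IsReward P F Y)
    (hUm : StronglyAdapted F U) (hU : ∀ t : ℝ≥0, U t =ᵐ[P] W fun _ => t) :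
    ∀ᵐ ω ∂P, IsRegularPath fun t => -U t ω :=
  ae_isRegularPath_neg (h.supermartingale hUm hU) (h.process_nonneg hY hU) fun _ =>
    h.process_le hY hU zero_le

/-- Right limits along the dyadic rationals are a version of the process. -/
theorem ae_eq_of_right_limit [F.IsRightContinuous] (h : RegularFamily P F Y c W)
    (hY : IsReward P F Y) (hU : ∀ t : ℝ≥0, U t =ᵐ[P] W fun _ => t) (hUm : StronglyAdapted F U)
    {t : ℝ≥0} {v : Ω → ℝ} (hv : Measurable[F t] v)
    (hlim : ∀ᵐ ω ∂P, Tendsto (fun j => U (dyadicUp j t) ω) atTop (nhds (v ω))) :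
    v =ᵐ[P] U t := by
  -- The same set integrals have two limits: uniform integrability yields the integral of v, and
  -- `rightCont` that of U t.
  obtain ⟨hvint, hconv⟩ := tendsto_setIntegral_of_le_condExp
    (𝒢 := fun j => F (dyadicUp j t)) (fun j => F.le _) ((hY.integrable_tailSup 0).const_mul c)
    (fun j => ((h.supermartingale hUm hU).integrable _).1)
    (fun j => h.process_nonneg hY hU _) (fun j => h.process_le hY hU zero_le) hlim
  have hUint := (h.supermartingale hUm hU).integrable t
  have heq : ∀ A, MeasurableSet[F t] A → ∫ ω in A, v ω ∂P = ∫ ω in A, U t ω ∂P := fun A hA => by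
    refine tendsto_nhds_unique (hconv A) ?_
    rw [← pastOf_const] at hA
    have := h.rightCont (θ := fun j _ => (dyadicUp j t : WithTop ℝ≥0)) (isStoppingTime_const F t)
      (fun j => isStoppingTime_const F _) (fun j _ => WithTop.coe_le_coe.2 (lt_dyadicUp j t).le)
      (fun _ => (WithTop.continuous_coe.tendsto t).comp (tendsto_dyadicUp t)) A hA
    rw [integral_congr_ae (ae_restrict_of_ae (hU t))]
    exact this.congr fun j => integral_congr_ae (ae_restrict_of_ae (hU _).symm)
  exact EventuallyLE.antisymm
    (ae_le_of_setIntegral_le (F.le t) hvint hUint hv.stronglyMeasurable.aestronglyMeasurable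
      (hUm t).aestronglyMeasurable fun A hA => (heq A hA).le)
    (ae_le_of_setIntegral_le (F.le t) hUint hvint (hUm t).aestronglyMeasurable
      hv.stronglyMeasurable.aestronglyMeasurable fun A hA => (heq A hA).ge)

/-- Off a null set the right limits along the dyadics exist and are right-continuous; on the null
set the path is set to zero. By `ae_eq_of_right_limit` the limits are a version of U. -/
theorem exists_modification [F.IsRightContinuous]
    (hF_null : ∀ N : Set Ω, MeasurableSet N → P N = 0 → MeasurableSet[F 0] N)
    (h : RegularFamily P F Y c W) (hY : IsReward P F Y) (hUm : StronglyAdapted F U)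
    (hU : ∀ t : ℝ≥0, U t =ᵐ[P] W fun _ => t) :
    ∃ V, IsRightContinuousModification P U V := by
  classical
  set N := toMeasurable P {ω | ¬ IsRegularPath fun t => -U t ω}
  have hN0 : P N = 0 := (measure_toMeasurable _).trans (h.ae_isRegularPath hY hUm hU)
  have hNF : MeasurableSet[F 0] N := hF_null N (measurableSet_toMeasurable _ _) hN0
  have hreg : ∀ ω ∉ N, IsRegularPath fun t => -U t ω := fun ω hω => by
    by_contra hc
    exact hω (subset_toMeasurable _ _ hc)
  have hex : ∀ ω, ∃ g : ℝ≥0 → ℝ, (ω ∉ N → ∀ t,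
      Tendsto (fun s => U s ω) (nhdsWithin t (dyadics ∩ Ioi t)) (nhds (g t))) ∧
      (ω ∈ N → g = 0) := fun ω => by
    by_cases hω : ω ∈ N
    · exact ⟨0, fun h => absurd hω h, fun _ => rfl⟩
    · choose g hg using (hreg ω hω).exists_right_limit
      refine ⟨fun t => -g t, fun _ t => ?_, fun h => absurd h hω⟩
      simpa using (hg t).neg
  choose g hg hg0 using hex
  have hlim : ∀ t ω, Tendsto (fun j => Nᶜ.indicator (U (dyadicUp j t)) ω) atTop (nhds (g ω t)) :=
    fun t ω => by
      by_cases hω : ω ∈ N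
      · simp [hω, hg0 ω hω]
      · simpa [hω, Function.comp_def] using (hg ω hω t).comp (tendsto_dyadicUp_nhdsWithin t)
  have hmeas : ∀ t, Measurable[F t] fun ω => g ω t := fun t A hA => by
    refine MeasurableSet.of_forall_gt fun s hs => ?_
    -- From index `j0` on the dyadic times lie before s, so the limit is F_s-measurable for every s
    -- > t.
    obtain ⟨j0, hj0⟩ := eventually_atTop.1 ((tendsto_dyadicUp t).eventually_lt_const hs)
    have hj : ∀ j, Measurable[F s] (Nᶜ.indicator (U (dyadicUp (j + j0) t))) := fun j =>
      ((hUm _).measurable.mono (F.mono (hj0 _ (Nat.le_add_left _ _)).le) le_rfl).indicator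
        (F.mono (zero_le) _ hNF.compl)
    have hm : Measurable[F s] fun ω => g ω t := @measurable_of_tendsto_metrizable Ω ℝ (F s) _ _ _ _
      _ _ hj
      (tendsto_pi_nhds.2 fun ω => (hlim t ω).comp (tendsto_add_atTop_nat j0))
    exact hm hA
  refine ⟨fun t ω => g ω t, fun t => (hmeas t).mono (F.le t) le_rfl, fun t => ?_, fun ω t => ?_⟩
  · refine h.ae_eq_of_right_limit hY hU hUm (hmeas t) ?_
    filter_upwards [measure_eq_zero_iff_ae_notMem.1 hN0] with ω hω
    exact (hg ω hω t).comp (tendsto_dyadicUp_nhdsWithin t)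
  · by_cases hω : ω ∈ N
    · simp only [hg0 ω hω]
      exact continuousWithinAt_const
    · exact continuousWithinAt_of_right_limits (hg ω hω) t

/-- A right-continuous modification of a regular family tends to `c · Y(∞)`. -/
theorem ae_tendsto_atTop (h : RegularFamily P F Y c W) (hY : IsReward P F Y)
    (hUm : StronglyAdapted F U) (hU : ∀ t : ℝ≥0, U t =ᵐ[P] W fun _ => t)
    (hV : IsRightContinuousModification P U V) :
    ∀ᵐ ω ∂P, Tendsto (fun t => V t ω) atTop (nhds (c * limitValue Y ω)) := by
  have hVU : ∀ᵐ ω ∂P, ∀ q ∈ dyadics, V q ω = U q ω :=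
    (ae_ball_iff countable_dyadics).2 fun q _ => hV.2.1 q
  have hlow : ∀ᵐ ω ∂P, ∀ n : ℕ, (P[fun ω => c * limitValue Y ω | F (n : ℝ≥0)]) ω ≤ U n ω := by
    refine ae_all_iff.2 fun n => ?_
    have := (h.condExp_le hY (isStoppingTime_const F (n : ℝ≥0))).trans (hU n).symm.le
    rwa [pastOf_const] at this
  have hup : ∀ᵐ ω ∂P, ∀ T n : ℕ, T ≤ n →
      U n ω ≤ (P[fun ω => c * tailSup Y T ω | F (n : ℝ≥0)]) ω := by
    refine ae_all_iff.2 fun T => ae_all_iff.2 fun n => ?_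
    by_cases hTn : T ≤ n
    · filter_upwards [h.process_le hY hU (T := T) (t := n) (by exact_mod_cast hTn)] with ω hω _
        using hω
    · exact Eventually.of_forall fun ω h => absurd h hTn
  have hL := ae_tendsto_condExp_natCast (F := F) (hY.integrable_limitValue.const_mul c)
    (hY.aestronglyMeasurable_limitValue.const_mul c)
  have hS : ∀ᵐ ω ∂P, ∀ T : ℕ, Tendsto (fun n : ℕ => (P[fun ω => c * tailSup Y T ω | F (n : ℝ≥0)]) ω)
      atTop (nhds (c * tailSup Y T ω)) := ae_all_iff.2 fun T =>
    ae_tendsto_condExp_natCast ((hY.integrable_tailSup T).const_mul c)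
      ((measurable_tailSup (fun t => (hY.adapted t).mono (le_iSup (fun t => F t) t) le_rfl)
        hY.right T).const_mul c).stronglyMeasurable.aestronglyMeasurable
  filter_upwards [hVU, hlow, hup, hL, hS, h.ae_isRegularPath hY hUm hU, hY.ae_bddAbove]
    with ω h1 h2 h3 h4 h5 h6 h7
  obtain ⟨x, hx⟩ := h6.exists_limit_atTop
  have hUx : Tendsto (fun t => U t ω) (atTop ⊓ 𝓟 dyadics) (nhds (-x)) := by simpa using hx.neg
  have hnat : Tendsto (fun n : ℕ => U n ω) atTop (nhds (-x)) :=
    hUx.comp (tendsto_inf.2 ⟨tendsto_natCast_atTop_atTop,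
      tendsto_principal.2 (Eventually.of_forall natCast_mem_dyadics)⟩)
  -- The limit is squeezed: Lévy's theorem turns the lower bound into c·Y(∞) and the upper bounds
  -- into c times the tail suprema, which decrease to c·Y(∞).
  have hxL : -x = c * limitValue Y ω := by
    refine le_antisymm ?_ (le_of_tendsto_of_tendsto' h4 hnat h2)
    refine ge_of_tendsto' ((tendsto_tailSup (fun t => hY.nonneg t ω) h7).const_mul c) fun T => ?_
    refine le_of_tendsto_of_tendsto hnat (h5 T) ?_
    filter_upwards [eventually_ge_atTop T] with n hn using h3 T n hn
  rw [← hxL]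
  exact tendsto_atTop_of_dyadics (hV.2.2 ω) h1 hUx

/-- Stopping a right-continuous modification of a regular family. -/
theorem valueAt_modification (h : RegularFamily P F Y c W) (hY : IsReward P F Y)
    (hUm : StronglyAdapted F U) (hU : ∀ t : ℝ≥0, U t =ᵐ[P] W fun _ => t)
    (hV : IsRightContinuousModification P U V) {τ : Ω → WithTop ℝ≥0} (hτ : IsStoppingTime F τ) :
    Integrable (valueAt V τ) P ∧ ∀ A, MeasurableSet[pastOf F τ] A →
      ∫ ω in A, valueAt V τ ω ∂P = ∫ ω in A, W τ ω ∂P := by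
  have hst : ∀ j, IsStoppingTime F (discretize j τ) := isStoppingTime_discretize hτ
  have hcong : ∀ j, valueAt V (discretize j τ) =ᵐ[P] W (discretize j τ) := fun j => by
    -- A discretized time has countably many values, so agreement with each constant time holds off
    -- a single null set. At the value ∞ both sides are c·Y(∞).
    have hall : ∀ᵐ ω ∂P, ∀ q ∈ range (discretize j τ), discretize j τ ω = q →
        valueAt V (discretize j τ) ω = W (discretize j τ) ω := by
      refine (ae_ball_iff (countable_range_discretize j)).2 fun q _ => ?_
      rcases q with _ | q
      · filter_upwards [h.congr (hst j) isStoppingTime_top, h.top hY,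
          h.ae_tendsto_atTop hY hUm hU hV] with ω e1 e2 e3 hω
        rw [e1 hω, e2, valueAt_of_eq_top hω]
        exact e3.limsup_eq
      · filter_upwards [h.congr (hst j) (isStoppingTime_const F q), hU q, hV.2.1 q]
          with ω e1 e2 e3 hω
        rw [e1 hω, valueAt_of_eq_coe hω, e3, e2]
    filter_upwards [hall] with ω hω using hω _ ⟨ω, rfl⟩ rfl
  obtain ⟨hint, hconv⟩ := tendsto_setIntegral_of_le_condExp
    (f := fun j => W (discretize j τ)) (g := valueAt V τ)
    (𝒢 := fun j => pastOf F (discretize j τ)) (fun j => pastOf_le F _)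
    ((hY.integrable_tailSup 0).const_mul c) (fun j => (h.integrable (hst j)).1)
    (fun j => h.nonneg hY (hst j)) (fun j => h.le_condExp hY (hst j) fun _ => bot_le) (by
      filter_upwards [ae_all_iff.2 hcong] with ω hω
      exact (tendsto_valueAt (hV.2.2 ω) (fun j => le_discretize j) tendsto_discretize).congr hω)
  exact ⟨hint, fun A hA => tendsto_nhds_unique (hconv A)
    (h.rightCont hτ hst (fun j _ => le_discretize j) (fun _ => tendsto_discretize) A hA)⟩

/-- At infinity a limsup of a sum splits because V converges a.s. -/
theorem valueAt_add_modification (h : RegularFamily P F Y c W) (hY : IsReward P F Y)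
    (hUm : StronglyAdapted F U) (hU : ∀ t : ℝ≥0, U t =ᵐ[P] W fun _ => t)
    (hV : IsRightContinuousModification P U V) (τ : Ω → WithTop ℝ≥0) :
    valueAt (Y + V) τ =ᵐ[P] fun ω => valueAt Y τ ω + valueAt V τ ω := by
  filter_upwards [h.ae_tendsto_atTop hY hUm hU hV, hY.ae_bddAbove] with ω hω hb
  rcases hτ : τ ω with _ | t
  · rw [valueAt_of_eq_top hτ, valueAt_of_eq_top hτ, valueAt_of_eq_top hτ]
    have hYb := isBoundedUnder_of_bddAbove hb
    have hY0 : IsBoundedUnder (· ≥ ·) atTop fun t => Y t ω :=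
      isBoundedUnder_of ⟨0, fun t => hY.nonneg t ω⟩
    refine le_antisymm ?_ ?_
    · exact limsup_add_le (u := fun t => Y t ω) (v := fun t => V t ω) hY0 hYb
        hω.isBoundedUnder_ge.isCoboundedUnder_le hω.isBoundedUnder_le
    · have := le_limsup_add (u := fun t => Y t ω) (v := fun t => V t ω) hYb
        hY0.isCoboundedUnder_le hω.isBoundedUnder_le hω.isBoundedUnder_ge
      rw [hω.liminf_eq] at this
      rw [limitValue, limitValue, limitValue, hω.limsup_eq]
      exact this
  · rw [valueAt_of_eq_coe hτ, valueAt_of_eq_coe hτ, valueAt_of_eq_coe hτ]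
    rfl

end RegularFamily

end Modification

/-! ### Splitting off the first exercise, and the main theorem -/

section Main

variable {Ω E : Type*} {m : MeasurableSpace Ω} {P : Measure Ω} [IsProbabilityMeasure P]
  {F : Filtration ℝ≥0 m} {Y : ℝ≥0 → Ω → ℝ} {X : ℝ≥0 → Ω → E}

/-- The continuation process is the restriction of a regular family to deterministic times, and
this family gives the optimal expected reward after the first exercise. -/
theorem exists_continuation_family (hY : IsReward P F Y) {k : ℕ} {B : Fin k → Set E}
    (hB : ∀ (i : Fin k) {τ}, IsStoppingTime F τ → IsStoppingTime F (entryTime X (B i) τ)) :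
    ∃ W : (Ω → WithTop ℝ≥0) → Ω → ℝ, RegularFamily P F Y k W ∧
      StronglyAdapted F (continuation P F Y X B) ∧
      (∀ t : ℝ≥0, continuation P F Y X B t =ᵐ[P] W fun _ => t) ∧
      (∀ {σ}, IsStoppingTime F σ → ∀ τ ∈ strategies F X B σ, ∀ A, MeasurableSet[pastOf F σ] A →
        ∫ ω in A, reward Y τ ω ∂P ≤ ∫ ω in A, valueAt Y (τ 0) ω ∂P + ∫ ω in A, W (τ 0) ω ∂P) ∧
      ∀ {τ}, IsStoppingTime F τ → ∃ θ : ℕ → Fin (k + 1) → Ω → WithTop ℝ≥0,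
        (∀ n, θ n ∈ strategies F X B τ) ∧ ∀ A, MeasurableSet[pastOf F τ] A →
          Tendsto (fun n => ∫ ω in A, reward Y (θ n) ω ∂P) atTop
            (nhds (∫ ω in A, valueAt Y τ ω ∂P + ∫ ω in A, W τ ω ∂P)) := by
  cases k with
  | zero =>
    refine ⟨fun _ => 0, by simpa using regularFamily_zero, fun t => stronglyMeasurable_zero,
      fun t => EventuallyEq.rfl, fun {σ} hσ τ hτ A hA => ?_, fun {τ} hτ => ⟨fun _ _ => τ,
      fun n => ⟨fun _ => hτ, le_rfl, fun i => i.elim0⟩, fun A hA => ?_⟩⟩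
    · simp [reward]
    · simp [reward]
  | succ k =>
    have hZ := regularFamily_multiValue (B := Fin.tail B) hY fun i => hB i.succ
    have hW := hZ.entryTime (hB 0)
    have hint : ∀ {τ}, IsStoppingTime F τ → ∀ A, MeasurableSet[pastOf F τ] A →
        ∫ ω in A, (P[multiValue P F Y X (Fin.tail B) (entryTime X (B 0) τ) | pastOf F τ]) ω ∂P =
          ∫ ω in A, multiValue P F Y X (Fin.tail B) (entryTime X (B 0) τ) ω ∂P := fun hτ A hA =>
      setIntegral_condExp (pastOf_le F _) (hZ.integrable (hB 0 hτ)) hA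
    have hreward : ∀ (τ : Fin (k + 2) → Ω → WithTop ℝ≥0) ω,
        reward Y τ ω = valueAt Y (τ 0) ω + reward Y (Fin.tail τ) ω := fun τ ω =>
      Fin.sum_univ_succ _
    have hmono : ∀ {τ}, IsStoppingTime F τ → pastOf F τ ≤ pastOf F (entryTime X (B 0) τ) :=
      fun hτ => pastOf_mono hτ (hB 0 hτ) fun _ => le_entryTime
    have hsum : ∀ {τ : Fin (k + 2) → Ω → WithTop ℝ≥0} {σ}, τ ∈ strategies F X B σ → ∀ A,
        ∫ ω in A, reward Y τ ω ∂P =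
          ∫ ω in A, valueAt Y (τ 0) ω ∂P + ∫ ω in A, reward Y (Fin.tail τ) ω ∂P :=
      fun {τ σ} hτ A => by
        simp only [hreward]
        exact integral_add (hY.integrable_valueAt (hτ.1 0)).integrableOn
          (integrable_finsetSum _ fun i _ => hY.integrable_valueAt (hτ.1 i.succ)).integrableOn
    refine ⟨_, by simpa using hW, fun t => stronglyMeasurable_condExp, fun t => ?_,
      fun {σ} hσ τ hτ A hA => ?_, fun {τ} hτ => ?_⟩
    · rw [pastOf_const]
      exact EventuallyEq.rfl
    -- The later exercises form a strategy started at the entry time after `τ 0`, so the value there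
    -- dominates their reward.
    · have hA' := pastOf_mono hσ (hτ.1 0) hτ.2.1 _ hA
      rw [hint (hτ.1 0) A hA', hsum hτ]
      exact add_le_add_right ((multiValue_spec (X := X) (B := Fin.tail B) hY (hB 0 (hτ.1 0))).2.2.1
        (Fin.tail τ) ⟨fun i => hτ.1 i.succ, hτ.2.2 0, fun i => hτ.2.2 i.succ⟩ A
        (hmono (hτ.1 0) _ hA')) _
    · obtain ⟨-, -, -, θ, hθ, hlim⟩ :=
        multiValue_spec (X := X) (B := Fin.tail B) hY (hB 0 hτ)
      -- Conversely, τ can be prepended to nearly optimal strategies started at its entry time.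
      have hmem : ∀ n, Fin.cons τ (θ n) ∈ strategies F X B τ := fun n => by
        refine ⟨fun i => ?_, le_rfl, fun i => ?_⟩
        · cases i using Fin.cases with
          | zero => exact hτ
          | succ i => exact (hθ n).1 i
        · cases i using Fin.cases with
          | zero => exact (hθ n).2.1
          | succ i => exact (hθ n).2.2 i
      refine ⟨fun n => Fin.cons τ (θ n), hmem, fun A hA => ?_⟩
      rw [hint hτ A hA]
      refine (tendsto_const_nhds.add (hlim A (hmono hτ _ hA))).congr fun n => ?_
      rw [hsum (hmem n)]
      rfl

end Main

end MultipleStopping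

theorem mainTheorem6 {Ω E : Type*} {m : MeasurableSpace Ω}
    [TopologicalSpace E] [MeasurableSpace E] [BorelSpace E]
    (P : Measure Ω) [IsProbabilityMeasure P]
    (F : Filtration ℝ≥0 m) (hF_right : F.IsRightContinuous)
    (hF_null : ∀ N : Set Ω, MeasurableSet N → P N = 0 → MeasurableSet[F 0] N)
    (Y : ℝ≥0 → Ω → ℝ) (hY_adapted : Adapted F Y) (hY_nonneg : ∀ t ω, 0 ≤ Y t ω)
    (hY_right : MultipleStopping.RightContinuousPaths Y)
    (hY_sup : ∫⁻ ω, ⨆ t, ENNReal.ofReal (Y t ω) ∂P < ∞)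
    (X : ℝ≥0 → Ω → E) (hX_adapted : Adapted F X)
    (hX_right : ∀ ω t, ContinuousWithinAt (fun s => X s ω) (Ici t) t)
    {k : ℕ} (B : Fin k → Set E) (hB : ∀ i, MeasurableSet (B i))
    (hB_finite : ∀ i, ∀ s : ℝ≥0, P (⋂ t > s, {ω | X t ω ∉ B i}) = 0)
    (hB_stop : ∀ i, ∀ s : ℝ≥0,
      IsStoppingTime F (MultipleStopping.entryTime X (B i) (fun _ => (s : WithTop ℝ≥0)))) :
    (∀ σ, IsStoppingTime F σ →
      MultipleStopping.IsEssSupFamily P (MultipleStopping.expectedRewards P F Y X B σ)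
        (MultipleStopping.multiValue P F Y X B σ) ∧
      Integrable (MultipleStopping.multiValue P F Y X B σ) P) ∧
    Supermartingale (MultipleStopping.continuation P F Y X B) F P ∧
    (∃ V, MultipleStopping.IsRightContinuousModification P
      (MultipleStopping.continuation P F Y X B) V) ∧
    ∀ V, MultipleStopping.IsRightContinuousModification P
        (MultipleStopping.continuation P F Y X B) V →
      Adapted F (Y + V) ∧ MultipleStopping.RightContinuousPaths (Y + V) ∧
      (∀ τ, IsStoppingTime F τ → Integrable (MultipleStopping.valueAt (Y + V) τ) P) ∧
      ∀ σ, IsStoppingTime F σ →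
        MultipleStopping.IsEssSupFamily P (MultipleStopping.singleRewards P F (Y + V) σ)
          (MultipleStopping.multiValue P F Y X B σ) := by
  have hY : MultipleStopping.IsReward P F Y := ⟨hY_adapted, hY_nonneg, hY_right, hY_sup⟩
  have hst : ∀ (i : Fin k) {τ}, IsStoppingTime F τ →
      IsStoppingTime F (MultipleStopping.entryTime X (B i) τ) := fun i _ hτ =>
    MultipleStopping.isStoppingTime_entryTime (hB_stop i) hτ
  obtain ⟨W, hW, hUm, hU, hle, happrox⟩ :=
    MultipleStopping.exists_continuation_family (P := P) hY hst
  refine ⟨fun σ hσ => ⟨MultipleStopping.isEssSupFamily_multiValue hY hσ,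
    (MultipleStopping.multiValue_spec hY hσ).2.1⟩, hW.supermartingale hUm hU,
    hW.exists_modification hF_null hY hUm hU, fun V hV => ⟨fun t => ?_, fun ω t => ?_,
    fun τ hτ => ?_, fun σ hσ => ?_⟩⟩
  · exact (hY_adapted t).add (MultipleStopping.measurable_of_ae_eq_of_null hF_null (hV.1 t)
      (hUm t).measurable (hV.2.1 t))
  · exact (hY_right ω t).add (hV.2.2 ω t)
  · exact ((hY.integrable_valueAt hτ).add (hW.valueAt_modification hY hUm hU hV hτ).1).congr
      (hW.valueAt_add_modification hY hUm hU hV τ).symm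
  · have hint : ∀ {τ}, IsStoppingTime F τ →
        Integrable (MultipleStopping.valueAt (Y + V) τ) P := fun {τ} hτ =>
      ((hY.integrable_valueAt hτ).add (hW.valueAt_modification hY hUm hU hV hτ).1).congr
        (hW.valueAt_add_modification hY hUm hU hV τ).symm
    have hsplit : ∀ {τ}, IsStoppingTime F τ → ∀ A, MeasurableSet[MultipleStopping.pastOf F τ] A →
        ∫ ω in A, MultipleStopping.valueAt (Y + V) τ ω ∂P =
          ∫ ω in A, MultipleStopping.valueAt Y τ ω ∂P + ∫ ω in A, W τ ω ∂P := fun {τ} hτ A hA => by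
      obtain ⟨h1, h2⟩ := hW.valueAt_modification hY hUm hU hV hτ
      rw [← h2 A hA, ← integral_add (hY.integrable_valueAt hτ).integrableOn h1.integrableOn]
      exact integral_congr_ae (ae_restrict_of_ae (hW.valueAt_add_modification hY hUm hU hV τ))
    have hσle := MultipleStopping.pastOf_le F σ
    obtain ⟨hm, -, hmin⟩ := MultipleStopping.isEssSupFamily_multiValue (X := X) (B := B) hY hσ
    obtain ⟨hZm, hZi, hZle, -⟩ := MultipleStopping.multiValue_spec (X := X) (B := B) hY hσ
    refine ⟨hm, ?_, fun W' hW'm hW' => hmin W' hW'm ?_⟩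
    -- The value is an upper bound: the reward of Y + V at τ is a limit of rewards of strategies
    -- starting with τ.
    · rintro _ ⟨τ, hτ, hστ, rfl⟩
      refine MultipleStopping.condExp_le_of_setIntegral_le hσle (hint hτ) hZi hZm fun A hA => ?_
      have hA' := MultipleStopping.pastOf_mono hσ hτ hστ _ hA
      obtain ⟨θ, hθ, hlim⟩ := happrox hτ
      rw [hsplit hτ A hA']
      exact le_of_tendsto' (hlim A hA') fun n =>
        hZle _ (MultipleStopping.strategies_antitone hστ (hθ n)) A hA
    -- It is the least one: each strategy is dominated by stopping Y + V at its first exercise time.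
    · rintro _ ⟨τ, hτ, rfl⟩
      refine EventuallyLE.trans ?_ (hW' _ ⟨τ 0, hτ.1 0, hτ.2.1, rfl⟩)
      refine MultipleStopping.condExp_le_of_setIntegral_le hσle (hY.integrable_reward hτ)
        integrable_condExp stronglyMeasurable_condExp.aestronglyMeasurable fun A hA => ?_
      rw [setIntegral_condExp hσle (hint (hτ.1 0)) hA,
        hsplit (hτ.1 0) A (MultipleStopping.pastOf_mono hσ (hτ.1 0) hτ.2.1 _ hA)]
      exact hle hσ τ hτ A hA
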